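/- **Proposition (modified test functions, bounded domain).** Let $\Omega\subset\mathbb R^2$ be a bounded open set, let $T>0$, and let $h_1,\dots,h_N:[0,T]\to\mathbb R^2$ be Lipschitz (i.e. $h_i\in W^{1,\infty}(0,T;\mathbb R^2)$). Let $\varphi\in C^\infty_c([0,T)\times\Omega;\mathbb R^2)$ (smooth up to $t=0$) satisfy $\operatorname{div}\varphi=0$, and let $\eta_1>0$ be such that $$|h_i(t)-h_j(t)|\ge 2\eta_1\quad\text{for all } t\in[0,T],\ i\ne j,\qquad \operatorname{dist}(\operatorname{supp}\varphi(t,\cdot),\partial\Omega)\ge 2\eta_1\quad\text{for all } t\in[0,T]$$ (the second condition being void at times when $\varphi(t,\cdot)=0$). Then for every $\eta\in(0,\eta_1]$ there exists $\varphi^\eta\in W^{1,\infty}_c([0,T);H^1_0(\Omega;\mathbb R^2))$ (that is, $\varphi^\eta$ and its weak time derivative $\partial_t\varphi^\eta$ belong to $L^\infty(0,T;H^1_0(\Omega))$, and $\varphi^\eta$, identified with its continuous representative on $[0,T)$, vanishes for $t$ close to $T$) such that $$\operatorname{div}\varphi^\eta=0\ \text{ in } [0,T)\times\Omega,\qquad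 \varphi^\eta(t,x)=0\ \text{ for } t\in[0,T),\ x\in\Omega\cap B\big(h_i(t),\tfrac{\eta}{2}\big),\ 1\le i\le N,$$ and, as $\eta\to0^+$, $$\varphi^\eta\overset{*}{\rightharpoonup}\varphi\ \text{ in } L^\infty(0,T;H^1(\Omega)),\qquad \partial_t\varphi^\eta\overset{*}{\rightharpoonup}\partial_t\varphi\ \text{ in } L^\infty(0,T;L^2(\Omega)).$$ -/

import Mathlib

open Set Filter Topology MeasureTheory
open scoped ContDiff

noncomputable section

namespace Fluid

/-- The plane `ℝ²` with its Euclidean norm. -/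
abbrev Plane : Type := EuclideanSpace ℝ (Fin 2)

/-- The standard basis vector `e_j` of the plane. -/
def basisVec (j : Fin 2) : Plane := EuclideanSpace.single j 1

/-- The classical partial derivative `∂_j f` of a vector field on the plane. -/
def partialDeriv (j : Fin 2) (f : Plane → Plane) (x : Plane) : Plane :=
  fderiv ℝ f x (basisVec j)

/-- The classical divergence `∂_1 f_1 + ∂_2 f_2`. -/
def divergence (f : Plane → Plane) (x : Plane) : ℝ :=
  ∑ j : Fin 2, partialDeriv j f x j

/-- Smooth compactly supported vector fields on the plane. -/
def SmoothCompact (f : Plane → Plane) : Prop :=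
  ContDiff ℝ ∞ f ∧ HasCompactSupport f

/-- `C_c^∞(Ω; ℝ²)`. -/
def IsTest (Ω : Set Plane) (f : Plane → Plane) : Prop :=
  SmoothCompact f ∧ tsupport f ⊆ Ω

theorem SmoothCompact.partialDeriv {f : Plane → Plane} (hf : SmoothCompact f) (j : Fin 2) :
    SmoothCompact (partialDeriv j f) :=
  ⟨(hf.1.fderiv_right (m := ∞) (by simp)).clm_apply contDiff_const,
    hf.2.fderiv_apply ℝ (basisVec j)⟩

theorem SmoothCompact.memLp {f : Plane → Plane} (hf : SmoothCompact f) (Ω : Set Plane) :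
    MemLp f 2 (volume.restrict Ω) :=
  (hf.1.continuous.memLp_of_hasCompactSupport hf.2).restrict Ω

/-! ### The spaces `L²(Ω)`, `H¹(Ω)`, `H¹₀(Ω)` of vector fields -/

/-- `L²(Ω; ℝ²)`. -/
abbrev L2 (Ω : Set Plane) : Type := Lp Plane 2 (volume.restrict Ω)

/-- Pairs `(u, (G_1, G_2))` of a field and a candidate for `(∂_1 u, ∂_2 u)`, with the Hilbert
structure `⟪(u, G), (v, H)⟫ = ⟪u, v⟫ + ⟪G_1, H_1⟫ + ⟪G_2, H_2⟫`. -/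
abbrev Jet (Ω : Set Plane) : Type := WithLp 2 (L2 Ω × PiLp 2 (fun _ : Fin 2 => L2 Ω))

/-- `G_j` is the weak derivative `∂_j u` in `Ω`, for `j = 1, 2`. -/
def IsWeakJet (Ω : Set Plane) (w : Jet Ω) : Prop :=
  ∀ (j : Fin 2) (θ : Plane → Plane), IsTest Ω θ →
    ∫ x in Ω, inner ℝ (w.fst x) (partialDeriv j θ x) = -∫ x in Ω, inner ℝ (w.snd j x) (θ x)

/-- The class in `L²(Ω)` of a field (zero if the field is not square integrable on `Ω`). -/
def toL2 (Ω : Set Plane) (f : Plane → Plane) : L2 Ω :=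
  open Classical in if h : MemLp f 2 (volume.restrict Ω) then h.toLp f else 0

theorem toL2_coe {Ω : Set Plane} {f : Plane → Plane} (h : MemLp f 2 (volume.restrict Ω)) :
    toL2 Ω f =ᵐ[volume.restrict Ω] f := by
  rw [toL2, dif_pos h]
  exact h.coeFn_toLp

theorem inner_toL2 {Ω : Set Plane} (u : L2 Ω) {f : Plane → Plane}
    (h : MemLp f 2 (volume.restrict Ω)) :
    inner ℝ u (toL2 Ω f) = ∫ x in Ω, inner ℝ (u x) (f x) := by
  rw [L2.inner_def]
  refine integral_congr_ae ?_
  filter_upwards [toL2_coe h] with x hx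
  rw [hx]

theorem isWeakJet_iff (Ω : Set Plane) (w : Jet Ω) :
    IsWeakJet Ω w ↔ ∀ (j : Fin 2) (θ : Plane → Plane), IsTest Ω θ →
      inner ℝ w.fst (toL2 Ω (partialDeriv j θ)) = -inner ℝ (w.snd j) (toL2 Ω θ) := by
  refine forall_congr' fun j => forall_congr' fun θ => forall_congr' fun hθ => ?_
  rw [inner_toL2 _ ((hθ.1.partialDeriv j).memLp Ω), inner_toL2 _ (hθ.1.memLp Ω)]

/-- The Hilbert space `H¹(Ω; ℝ²)`, whose elements are recorded with their weak derivatives. -/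
def H1 (Ω : Set Plane) : Submodule ℝ (Jet Ω) where
  carrier := {w | IsWeakJet Ω w}
  zero_mem' := by
    rw [mem_ofPred_eq, isWeakJet_iff]
    intro j θ _
    simp
  add_mem' := by
    intro a b ha hb
    rw [mem_ofPred_eq, isWeakJet_iff] at *
    intro j θ hθ
    simp only [WithLp.add_fst, WithLp.add_snd, PiLp.add_apply, inner_add_left, ha j θ hθ,
      hb j θ hθ]
    ring
  smul_mem' := by
    intro c a ha
    rw [mem_ofPred_eq, isWeakJet_iff] at *
    intro j θ hθ
    simp only [WithLp.smul_fst, WithLp.smul_snd, PiLp.smul_apply, real_inner_smul_left,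
      ha j θ hθ]
    ring

/-- The field underlying an element of `H¹(Ω)`. -/
def fieldOf {Ω : Set Plane} (w : H1 Ω) : L2 Ω := (w : Jet Ω).fst

/-- The weak derivative `∂_j w`. -/
def weakPartial {Ω : Set Plane} (w : H1 Ω) (j : Fin 2) : L2 Ω := (w : Jet Ω).snd j

/-- The weak divergence of an element of `H¹(Ω)`. -/
def weakDiv {Ω : Set Plane} (w : H1 Ω) (x : Plane) : ℝ := ∑ j : Fin 2, weakPartial w j x j

theorem H1.isClosed (Ω : Set Plane) : IsClosed (H1 Ω : Set (Jet Ω)) := by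
  have h : (H1 Ω : Set (Jet Ω)) = ⋂ (j : Fin 2) (θ : Plane → Plane) (_ : IsTest Ω θ),
      {w : Jet Ω | inner ℝ w.fst (toL2 Ω (partialDeriv j θ)) =
        -inner ℝ (w.snd j) (toL2 Ω θ)} := by
    ext w
    simp only [mem_iInter, mem_ofPred_eq]
    exact isWeakJet_iff Ω w
  rw [h]
  refine isClosed_iInter fun j => isClosed_iInter fun θ => isClosed_iInter fun _ => ?_
  have h1 : Continuous fun w : Jet Ω => w.fst :=
    continuous_fst.comp (WithLp.prod_continuous_ofLp 2 _ _)
  have h2 : Continuous fun w : Jet Ω => w.snd j :=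
    (PiLp.continuous_apply 2 (fun _ : Fin 2 => L2 Ω) j).comp
      (continuous_snd.comp (WithLp.prod_continuous_ofLp 2 _ _))
  exact isClosed_eq (h1.inner continuous_const) (h2.inner continuous_const).neg

instance (Ω : Set Plane) : CompleteSpace (H1 Ω) := (H1.isClosed Ω).completeSpace_coe

/-- A smooth compactly supported field, restricted to `Ω`, with its classical derivatives. -/
def smoothJet (Ω : Set Plane) (f : Plane → Plane) : Jet Ω :=
  WithLp.toLp 2 (toL2 Ω f, WithLp.toLp 2 fun j => toL2 Ω (partialDeriv j f))

theorem smoothJet_mem (Ω : Set Plane) {f : Plane → Plane} (hf : SmoothCompact f) :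
    smoothJet Ω f ∈ H1 Ω := by
  intro j θ hθ
  have e1 : ∫ x in Ω, inner ℝ ((smoothJet Ω f).fst x) (partialDeriv j θ x) =
      ∫ x in Ω, inner ℝ (f x) (partialDeriv j θ x) := by
    refine integral_congr_ae ?_
    filter_upwards [toL2_coe (hf.memLp Ω)] with x hx
    rw [show (smoothJet Ω f).fst x = f x from hx]
  have e2 : ∫ x in Ω, inner ℝ ((smoothJet Ω f).snd j x) (θ x) =
      ∫ x in Ω, inner ℝ (partialDeriv j f x) (θ x) := by
    refine integral_congr_ae ?_
    filter_upwards [toL2_coe ((hf.partialDeriv j).memLp Ω)] with x hx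
    rw [show (smoothJet Ω f).snd j x = partialDeriv j f x from hx]
  have hθ0 : ∀ x, x ∉ Ω → θ x = 0 := fun x hx => image_eq_zero_of_notMem_tsupport
    fun h => hx (hθ.2 h)
  have hdθ0 : ∀ x, x ∉ Ω → partialDeriv j θ x = 0 := fun x hx => by
    have : fderiv ℝ θ x = 0 := image_eq_zero_of_notMem_tsupport
      fun h => hx (hθ.2 (tsupport_fderiv_subset ℝ h))
    simp [partialDeriv, this]
  rw [e1, e2, setIntegral_eq_integral_of_forall_compl_eq_zero
      fun x hx => by rw [hdθ0 x hx, inner_zero_right],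
    setIntegral_eq_integral_of_forall_compl_eq_zero
      fun x hx => by rw [hθ0 x hx, inner_zero_right]]
  have hc : ∀ {g k : Plane → Plane}, SmoothCompact g → SmoothCompact k →
      Integrable fun x => inner ℝ (g x) (k x) := by
    intro g k hg hk
    refine (hg.1.continuous.inner hk.1.continuous).integrable_of_hasCompactSupport ?_
    refine hg.2.mono fun x hx => ?_
    contrapose! hx
    simp only [Function.mem_support, not_not] at hx
    simp [hx]
  exact integral_bilinear_hasFDerivAt_right_eq_neg_left_of_integrable (μ := volume)
    (B := innerSL ℝ) (f := f) (g := θ) (f' := fderiv ℝ f) (g' := fderiv ℝ θ)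
    (v := basisVec j) (hc (hf.partialDeriv j) hθ.1) (hc hf (hθ.1.partialDeriv j))
    (hc hf hθ.1)
    (fun x _ => (hf.1.differentiable (by simp) x).hasFDerivAt)
    (fun x _ => (hθ.1.1.differentiable (by simp) x).hasFDerivAt)

/-- The element of `H¹(Ω)` given by a smooth compactly supported field (zero for other fields). -/
def toH1 (Ω : Set Plane) (f : Plane → Plane) : H1 Ω :=
  open Classical in if h : SmoothCompact f then ⟨smoothJet Ω f, smoothJet_mem Ω h⟩ else 0

/-- `H¹₀(Ω; ℝ²)`: the closure of `C_c^∞(Ω; ℝ²)` in `H¹(Ω; ℝ²)`. -/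
def H10 (Ω : Set Plane) : Submodule ℝ (H1 Ω) :=
  (Submodule.span ℝ {w : H1 Ω | ∃ f, IsTest Ω f ∧ w = toH1 Ω f}).topologicalClosure

instance (Ω : Set Plane) : CompleteSpace (H10 Ω) :=
  (Submodule.isClosed_topologicalClosure _).completeSpace_coe

/-! ### Functions of time with values in a Hilbert space -/

/-- `u ∈ W^{1,∞}_c([0,T); X)` with weak derivative `∂_t u = u'`. As usual `u` is taken to be the
continuous representative; it vanishes for `t` close to `T`. -/
structure IsW1InftyC {X : Type*} [NormedAddCommGroup X] [NormedSpace ℝ X] (T : ℝ)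
    (u u' : ℝ → X) : Prop where
  memLp : MemLp u ⊤ (volume.restrict (Ioo 0 T))
  memLp_deriv : MemLp u' ⊤ (volume.restrict (Ioo 0 T))
  weak_deriv : ∀ θ : ℝ → ℝ, ContDiff ℝ ∞ θ → HasCompactSupport θ → tsupport θ ⊆ Ioo 0 T →
    ∫ t in Ioo 0 T, deriv θ t • u t = -∫ t in Ioo 0 T, θ t • u' t
  continuousOn : ContinuousOn u (Ico 0 T)
  compact_support : ∃ τ < T, ∀ t ∈ Ico 0 T, τ ≤ t → u t = 0

/-- Weak-* convergence in `L^∞(0,T; H) = L^1(0,T; H)*`, for a Hilbert space `H`. -/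
structure WeakStarTendsto {ι H : Type*} [NormedAddCommGroup H] [InnerProductSpace ℝ H] (T : ℝ)
    (l : Filter ι) (f : ι → ℝ → H) (g : ℝ → H) : Prop where
  eventually_memLp : ∀ᶠ i in l, MemLp (f i) ⊤ (volume.restrict (Ioo 0 T))
  memLp_limit : MemLp g ⊤ (volume.restrict (Ioo 0 T))
  tendsto : ∀ ψ : ℝ → H, IntegrableOn ψ (Ioo 0 T) →
    Tendsto (fun i => ∫ t in Ioo 0 T, inner ℝ (f i t) (ψ t)) l
      (𝓝 (∫ t in Ioo 0 T, inner ℝ (g t) (ψ t)))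

/-- `φ ∈ C_c^∞([0,T) × Ω; ℝ²)`, extended by zero for `x ∉ Ω`; smoothness is up to `t = 0`, and the
support is a compact subset of `[0,T) × Ω`. Values for `t ∉ [0,T)` are irrelevant. -/
structure IsSpaceTimeTest (T : ℝ) (Ω : Set Plane) (φ : ℝ → Plane → Plane) : Prop where
  contDiffOn : ContDiffOn ℝ ∞ (fun p : ℝ × Plane => φ p.1 p.2) (Ico 0 T ×ˢ univ)
  compact_support : ∃ K : Set (ℝ × Plane), IsCompact K ∧ K ⊆ Ico 0 T ×ˢ Ω ∧
    ∀ t ∈ Ico 0 T, ∀ x, (t, x) ∉ K → φ t x = 0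

end Fluid

end

/-! Extended by zero, `φ t` is a smooth divergence-free field on the whole plane, so it is the
rotated gradient of a stream function `ψ t`, whatever the topology of Ω. The modified field is `φ -
∑ i, ∇^⊥(χ_η(x - h i t) (ψ t x - ψ t (h i t)))`, where the cutoff `χ_η` is `1` on the disc of radius
`η/2` and `0` outside radius `3η/4`. Each correction is a rotated gradient, hence divergence free.
It equals `φ t` on the inner disc, and the separation of the points keeps the other corrections away
from that disc, so the difference vanishes there.

Everything rests on normalising `ψ` to vanish at the moving point: `|ψ t x - ψ t (h i t)|` is at
most of order `η` on the support of the cutoff, which cancels one factor `η⁻¹`. The correction, its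
space derivatives and its time derivative are then at most of order `η⁻¹` on a disc of radius `η`
(`exists_movingCorrection_bounds`). In dimension two such fields are bounded in `L²` and tend weakly
to zero, since their supports shrink to a point (`norm_toL2_le_of_concentrated`,
`tendsto_inner_toL2_of_concentrated`). Dominated convergence in time turns this into weak-*
convergence (`weakStarTendsto_of_pointwise`).

For fixed `η` the family is Lipschitz in time with values in `H¹` and differentiable at every time
where all the curves `h i` are, hence almost everywhere by Rademacher; this gives `W^{1,∞}`
regularity with no uniformity in `η` (`TimeField.exists_isW1InftyC`). The corrections stay in Ω
because a disc on which `φ t` does not vanish identically is too far from the boundary to cross it,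
and on the other discs the normalised stream function vanishes (`isTest_correction`). -/

noncomputable section

namespace Fluid

/-! ### Stream functions in the plane -/

/-- The linear form `v ↦ v₁ w₂ - v₂ w₁`. -/
def wedge : Plane →L[ℝ] Plane →L[ℝ] ℝ :=
  (EuclideanSpace.proj (𝕜 := ℝ) (1 : Fin 2)).smulRight (EuclideanSpace.proj (𝕜 := ℝ) (0 : Fin 2)) -
    (EuclideanSpace.proj (𝕜 := ℝ) (0 : Fin 2)).smulRight
      (EuclideanSpace.proj (𝕜 := ℝ) (1 : Fin 2))

theorem wedge_apply (w v : Plane) : wedge w v = w 1 * v 0 - w 0 * v 1 := by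
  simp [wedge]

/-- The vector `(-ℓ(e₂), ℓ(e₁))`. -/
def rot : (Plane →L[ℝ] ℝ) →L[ℝ] Plane :=
  (ContinuousLinearMap.apply ℝ ℝ (basisVec 0)).smulRight (basisVec 1) -
    (ContinuousLinearMap.apply ℝ ℝ (basisVec 1)).smulRight (basisVec 0)

theorem rot_apply (l : Plane →L[ℝ] ℝ) :
    rot l = l (basisVec 0) • basisVec 1 - l (basisVec 1) • basisVec 0 := rfl

theorem rot_apply_zero (l : Plane →L[ℝ] ℝ) : rot l 0 = -l (basisVec 1) := by
  simp [rot_apply, basisVec]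

theorem rot_apply_one (l : Plane →L[ℝ] ℝ) : rot l 1 = l (basisVec 0) := by
  simp [rot_apply, basisVec]

/-- Thus `dψ = wedge f` means that `f` is the rotated gradient of `ψ`. -/
theorem rot_wedge (w : Plane) : rot (wedge w) = w := by
  ext j
  fin_cases j
  · simp [rot_apply_zero, wedge_apply, basisVec]
  · simp [rot_apply_one, wedge_apply, basisVec]

theorem norm_basisVec (j : Fin 2) : ‖basisVec j‖ = 1 := by simp [basisVec]

theorem eq_sum_basisVec (v : Plane) : v = v 0 • basisVec 0 + v 1 • basisVec 1 := by
  ext j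
  fin_cases j <;> simp [basisVec]

theorem norm_wedge_le (w v : Plane) : |wedge w v| ≤ 2 * ‖w‖ * ‖v‖ := by
  have h0 := PiLp.norm_apply_le w 0
  have h1 := PiLp.norm_apply_le w 1
  have h2 := PiLp.norm_apply_le v 0
  have h3 := PiLp.norm_apply_le v 1
  rw [wedge_apply]
  refine (abs_sub _ _).trans ?_
  rw [abs_mul, abs_mul]
  have := mul_le_mul h1 h2 (norm_nonneg _) (norm_nonneg _)
  have := mul_le_mul h0 h3 (norm_nonneg _) (norm_nonneg _)
  simp only [Real.norm_eq_abs] at *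
  linarith

/-- The rotated gradient `(-∂_2 a, ∂_1 a)`. -/
def rotGrad (a : Plane → ℝ) (x : Plane) : Plane := rot (fderiv ℝ a x)

theorem _root_.ContDiff.rotGrad {a : Plane → ℝ} (ha : ContDiff ℝ ∞ a) : ContDiff ℝ ∞ (rotGrad a) :=
  rot.contDiff.comp (ha.fderiv_right (m := ∞) (by simp))

theorem divergence_rotGrad {a : Plane → ℝ} (ha : ContDiff ℝ ∞ a) (x : Plane) :
    divergence (rotGrad a) x = 0 := by
  have hd : DifferentiableAt ℝ (fderiv ℝ a) x :=
    (ha.fderiv_right (m := ∞) (by simp)).differentiable (by simp) x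
  have h1 : HasFDerivAt (rotGrad a) (rot.comp (fderiv ℝ (fderiv ℝ a) x)) x :=
    rot.hasFDerivAt.comp x hd.hasFDerivAt
  have hs : IsSymmSndFDerivAt ℝ a x :=
    ha.contDiffAt.isSymmSndFDerivAt (by
      simpa using (WithTop.coe_le_coe.2 le_top : ((2 : ℕ∞) : WithTop ℕ∞) ≤ ∞))
  simp only [divergence, partialDeriv, h1.fderiv, Fin.sum_univ_two, ContinuousLinearMap.comp_apply,
    rot_apply_zero, rot_apply_one]
  rw [hs (basisVec 0) (basisVec 1)]
  ring

/-- In the plane the antisymmetric part of `(u, v) ↦ wedge (A u) v` is the trace of `A` times a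
determinant. With `A` the derivative of `f`, this says that the form `wedge f` is closed when `div f
= 0`. -/
theorem wedge_map_symm (A : Plane →L[ℝ] Plane) (hA : A (basisVec 0) 0 + A (basisVec 1) 1 = 0)
    (u v : Plane) : wedge (A u) v = wedge (A v) u := by
  have hu : A u = u 0 • A (basisVec 0) + u 1 • A (basisVec 1) := by
    conv_lhs => rw [eq_sum_basisVec u]
    simp
  have hv : A v = v 0 • A (basisVec 0) + v 1 • A (basisVec 1) := by
    conv_lhs => rw [eq_sum_basisVec v]
    simp
  simp only [wedge_apply, hu, hv, PiLp.add_apply, PiLp.smul_apply, smul_eq_mul]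
  linear_combination (v 0 * u 1 - u 0 * v 1) * hA

/-- The Poincaré lemma on the plane, which is convex. -/
theorem exists_stream {f : Plane → Plane} (hf : ContDiff ℝ ∞ f) (hdiv : ∀ x, divergence f x = 0) :
    ∃ ψ : Plane → ℝ, ∀ x, HasFDerivAt ψ (wedge (f x)) x := by
  have hω : ∀ x, HasFDerivAt (fun x => wedge (f x)) (wedge.comp (fderiv ℝ f x)) x := fun x =>
    wedge.hasFDerivAt.comp x (hf.differentiable (by simp) x).hasFDerivAt
  obtain ⟨ψ, hψ⟩ := convex_univ.exists_forall_hasFDerivAt_of_fderiv_symmetric isOpen_univ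
    (fun x _ => (hω x).differentiableAt.differentiableWithinAt)
    (fun a _ x y => by
      rw [(hω a).fderiv]
      refine wedge_map_symm _ ?_ x y
      simpa [divergence, partialDeriv, Fin.sum_univ_two] using hdiv a)
  exact ⟨ψ, fun x => hψ x (mem_univ x)⟩

/-- The increment from `c` to `x` of a stream function of the field `f`. -/
def streamIncr (f : Plane → Plane) (c x : Plane) : ℝ :=
  ∫ s in (0 : ℝ)..1, wedge (f (c + s • (x - c))) (x - c)

/-- The segment integral makes the normalised stream function explicit in the field and the base
point, so it can be differentiated in time; the link with an abstract `ψ` supplies its properties in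
space. -/
theorem streamIncr_eq_sub {f : Plane → Plane} (hf : Continuous f) {ψ : Plane → ℝ}
    (hψ : ∀ x, HasFDerivAt ψ (wedge (f x)) x) (c x : Plane) :
    streamIncr f c x = ψ x - ψ c := by
  have h : ∀ s ∈ uIcc (0 : ℝ) 1, HasDerivAt (fun s : ℝ => ψ (c + s • (x - c)))
      (wedge (f (c + s • (x - c))) (x - c)) s := by
    intro s _
    have h1 : HasDerivAt (fun s : ℝ => c + s • (x - c)) (x - c) s := by
      simpa using ((hasDerivAt_id s).smul_const (x - c)).const_add c
    exact (hψ _).comp_hasDerivAt s h1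
  have hc : Continuous fun s : ℝ => wedge (f (c + s • (x - c))) (x - c) := by fun_prop
  rw [streamIncr, intervalIntegral.integral_eq_sub_of_hasDerivAt h (hc.intervalIntegrable _ _)]
  simp

theorem abs_streamIncr_le {f : Plane → Plane} {M : ℝ} (hM : ∀ x, ‖f x‖ ≤ M) (c x : Plane) :
    |streamIncr f c x| ≤ 2 * M * ‖x - c‖ := by
  have := intervalIntegral.norm_integral_le_of_norm_le_const (a := 0) (b := 1)
    (f := fun s : ℝ => wedge (f (c + s • (x - c))) (x - c)) (C := 2 * M * ‖x - c‖)
    (fun s _ => (norm_wedge_le _ _).trans (by gcongr; exact hM _))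
  rwa [sub_zero, abs_one, mul_one] at this

theorem streamIncr_sub {f g : Plane → Plane} (hf : Continuous f) (hg : Continuous g)
    (c x : Plane) : streamIncr f c x - streamIncr g c x = streamIncr (fun y => f y - g y) c x := by
  have h : ∀ {f : Plane → Plane}, Continuous f →
      Continuous fun s : ℝ => wedge (f (c + s • (x - c))) (x - c) := fun _ => by fun_prop
  rw [streamIncr, streamIncr, ← intervalIntegral.integral_sub ((h hf).intervalIntegrable _ _)
    ((h hg).intervalIntegrable _ _)]
  simp [streamIncr]

theorem streamIncr_eq_zero {f : Plane → Plane} {c x : Plane} {r : ℝ}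
    (hf : ∀ y ∈ Metric.ball c r, f y = 0) (hx : x ∈ Metric.ball c r) : streamIncr f c x = 0 := by
  refine intervalIntegral.integral_zero_ae (ae_of_all _ fun s hs => ?_)
  rw [uIoc_of_le zero_le_one] at hs
  rw [hf, map_zero, _root_.zero_apply]
  rw [mem_ball_iff_norm] at hx ⊢
  rw [add_sub_cancel_left, norm_smul, Real.norm_eq_abs, abs_of_pos hs.1]
  nlinarith [norm_nonneg (x - c), hs.2]

theorem hasFDerivAt_streamIncr {f : Plane → Plane} (hf : ContDiff ℝ ∞ f)
    (hdiv : ∀ x, divergence f x = 0) (c x : Plane) :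
    HasFDerivAt (streamIncr f c) (wedge (f x)) x := by
  obtain ⟨ψ, hψ⟩ := exists_stream hf hdiv
  rw [show streamIncr f c = fun x => ψ x - ψ c from
    funext fun x => streamIncr_eq_sub hf.continuous hψ c x]
  exact (hψ x).sub_const _

/-- Path independence: moving the base point changes the stream function by a constant in `x`. This
controls the motion of the centre of the correction. -/
theorem streamIncr_sub_left {f : Plane → Plane} (hf : ContDiff ℝ ∞ f)
    (hdiv : ∀ x, divergence f x = 0) (c d x : Plane) :
    streamIncr f c x - streamIncr f d x = streamIncr f c d := by
  obtain ⟨ψ, hψ⟩ := exists_stream hf hdiv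
  simp only [streamIncr_eq_sub hf.continuous hψ]
  ring

theorem contDiff_streamIncr {f : Plane → Plane} (hf : ContDiff ℝ ∞ f)
    (hdiv : ∀ x, divergence f x = 0) (c : Plane) : ContDiff ℝ ∞ (streamIncr f c) := by
  have h := hasFDerivAt_streamIncr hf hdiv c
  rw [contDiff_infty_iff_fderiv]
  refine ⟨fun x => (h x).differentiableAt, ?_⟩
  rw [show fderiv ℝ (streamIncr f c) = fun x => wedge (f x) from funext fun x => (h x).fderiv]
  exact wedge.contDiff.comp hf

/-! ### Square integrable fields -/

section L2

variable {Ω : Set Plane} {f g : Plane → Plane}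

theorem toL2_eq (h : MemLp f 2 (volume.restrict Ω)) : toL2 Ω f = h.toLp f := dif_pos h

theorem toL2_sub (hf : MemLp f 2 (volume.restrict Ω)) (hg : MemLp g 2 (volume.restrict Ω)) :
    toL2 Ω (fun x => f x - g x) = toL2 Ω f - toL2 Ω g := by
  rw [toL2_eq hf, toL2_eq hg, ← MemLp.toLp_sub]
  exact toL2_eq (hf.sub hg)

theorem toL2_smul (c : ℝ) (hf : MemLp f 2 (volume.restrict Ω)) :
    toL2 Ω (fun x => c • f x) = c • toL2 Ω f := by
  rw [toL2_eq hf, ← MemLp.toLp_const_smul]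
  exact toL2_eq (hf.const_smul c)

theorem toL2_zero : toL2 Ω (fun _ => 0) = 0 := by
  rw [toL2_eq MemLp.zero']
  exact MemLp.toLp_zero _

theorem toL2_sum {ι : Type*} (s : Finset ι) {f : ι → Plane → Plane}
    (hf : ∀ i, MemLp (f i) 2 (volume.restrict Ω)) :
    toL2 Ω (fun x => ∑ i ∈ s, f i x) = ∑ i ∈ s, toL2 Ω (f i) := by
  classical
  induction s using Finset.induction_on with
  | empty => simpa using toL2_zero
  | insert i s hi ih =>
    have h : MemLp (fun x => ∑ i ∈ s, f i x) 2 (volume.restrict Ω) :=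
      memLp_finsetSum s fun i _ => hf i
    simp only [Finset.sum_insert hi, ← ih]
    rw [toL2_eq (hf i), toL2_eq h, ← MemLp.toLp_add]
    exact toL2_eq ((hf i).add h)

theorem norm_sq_toL2 (h : MemLp f 2 (volume.restrict Ω)) :
    ‖toL2 Ω f‖ ^ 2 = ∫ x in Ω, ‖f x‖ ^ 2 := by
  rw [← real_inner_self_eq_norm_sq, inner_toL2 _ h]
  refine integral_congr_ae ?_
  filter_upwards [toL2_coe h] with x hx
  rw [hx, real_inner_self_eq_norm_sq]

/-- The factor between uniform bounds and bounds in `L²(Ω)`. -/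
def supToL2 (Ω : Set Plane) : ℝ :=
  (volume.restrict Ω).real univ ^ (ENNReal.toReal 2)⁻¹

theorem supToL2_nonneg (Ω : Set Plane) : 0 ≤ supToL2 Ω := by unfold supToL2; positivity

theorem norm_toL2_le [IsFiniteMeasure (volume.restrict Ω)] {C : ℝ} (hC : ∀ x, ‖f x‖ ≤ C) :
    ‖toL2 Ω f‖ ≤ supToL2 Ω * C := by
  have hC0 : 0 ≤ C := (norm_nonneg _).trans (hC 0)
  by_cases h : MemLp f 2 (volume.restrict Ω)
  · refine Lp.norm_le_of_ae_bound hC0 ?_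
    filter_upwards [toL2_coe h] with x hx
    rw [hx]
    exact hC x
  · rw [toL2, dif_neg h, norm_zero]
    exact mul_nonneg (supToL2_nonneg Ω) hC0

/-- A derivative is a limit of difference quotients. The quotient is replaced by `0` at those `s`
where `F s` may fail to be measurable, since the limit theorem wants measurability for every `s`. -/
theorem aestronglyMeasurable_of_hasDerivAt {α E : Type*} [MeasurableSpace α] {μ : Measure α}
    [NormedAddCommGroup E] [NormedSpace ℝ E] {F : ℝ → α → E} {F' : α → E} {t : ℝ}
    (hF : ∀ᶠ s in 𝓝 t, AEStronglyMeasurable (F s) μ)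
    (hd : ∀ x, HasDerivAt (fun s => F s x) (F' x) t) : AEStronglyMeasurable F' μ := by
  classical
  refine aestronglyMeasurable_of_tendsto_ae (𝓝[≠] t)
    (f := fun s x => if AEStronglyMeasurable (F s) μ then (s - t)⁻¹ • (F s x - F t x) else 0)
    (fun s => ?_) (ae_of_all _ fun x => (hasDerivAt_iff_tendsto_slope.1 (hd x)).congr' ?_)
  · by_cases hs : AEStronglyMeasurable (F s) μ
    · simpa only [hs, if_true] using! ((hs.sub hF.self_of_nhds).const_smul (s - t)⁻¹)
    · simpa only [hs, if_false] using aestronglyMeasurable_const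
  · filter_upwards [hF.filter_mono nhdsWithin_le_nhds] with s hs
    simp only [hs, if_true, slope_def_module]

/-- The difference quotients converge pointwise and are bounded by `L`; on a domain of finite
measure, dominated convergence upgrades this to convergence in `L²`. -/
theorem hasDerivAt_toL2 [IsFiniteMeasure (volume.restrict Ω)] {f : ℝ → Plane → Plane}
    {f' : Plane → Plane} {t L : ℝ}
    (hmem : ∀ᶠ s in 𝓝 t, MemLp (f s) 2 (volume.restrict Ω))
    (hlip : ∀ᶠ s in 𝓝 t, ∀ x, ‖f s x - f t x‖ ≤ L * |s - t|)
    (hd : ∀ x, HasDerivAt (fun s => f s x) (f' x) t) :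
    MemLp f' 2 (volume.restrict Ω) ∧ (∀ x, ‖f' x‖ ≤ L) ∧
      HasDerivAt (fun s => toL2 Ω (f s)) (toL2 Ω f') t := by
  have ht : MemLp (f t) 2 (volume.restrict Ω) := hmem.self_of_nhds
  have hsl : ∀ x, Tendsto (fun s => (s - t)⁻¹ • (f s x - f t x)) (𝓝[≠] t) (𝓝 (f' x)) := fun x =>
    hasDerivAt_iff_tendsto_slope.1 (hd x)
  have hbd : ∀ᶠ s in 𝓝[≠] t, ∀ x, ‖(s - t)⁻¹ • (f s x - f t x)‖ ≤ L := by
    filter_upwards [hlip.filter_mono nhdsWithin_le_nhds, self_mem_nhdsWithin] with s hs hst x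
    have : 0 < |s - t| := abs_pos.2 (sub_ne_zero.2 hst)
    rw [norm_smul, norm_inv, Real.norm_eq_abs, inv_mul_le_iff₀ this]
    linarith [hs x]
  have hf'b : ∀ x, ‖f' x‖ ≤ L := fun x =>
    le_of_tendsto (hsl x).norm (hbd.mono fun s hs => hs x)
  have hf'm : AEStronglyMeasurable f' (volume.restrict Ω) :=
    aestronglyMeasurable_of_hasDerivAt (hmem.mono fun s hs => hs.1) hd
  have hf' : MemLp f' 2 (volume.restrict Ω) := MemLp.of_bound hf'm L (ae_of_all _ hf'b)
  refine ⟨hf', hf'b, hasDerivAt_iff_tendsto_slope.2 (tendsto_iff_norm_sub_tendsto_zero.2 ?_)⟩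
  have key : Tendsto (fun s => ∫ x in Ω, ‖(s - t)⁻¹ • (f s x - f t x) - f' x‖ ^ 2) (𝓝[≠] t)
      (𝓝 (∫ _ in Ω, (0 : ℝ))) := by
    refine tendsto_integral_filter_of_dominated_convergence (fun _ => (2 * L) ^ 2) ?_ ?_
      (integrable_const _) (ae_of_all _ fun x => ?_)
    · filter_upwards [hmem.filter_mono nhdsWithin_le_nhds] with s hs
      exact ((((hs.sub ht).const_smul (s - t)⁻¹).sub hf').1.norm.pow 2)
    · filter_upwards [hbd] with s hs
      refine ae_of_all _ fun x => ?_
      rw [norm_pow, norm_norm]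
      gcongr
      exact (norm_sub_le _ _).trans (by linarith [hs x, hf'b x])
    · simpa using! ((hsl x).sub_const (f' x)).norm.pow 2
  rw [integral_zero] at key
  have key' := key.sqrt
  rw [Real.sqrt_zero] at key'
  refine key'.congr' ?_
  filter_upwards [hmem.filter_mono nhdsWithin_le_nhds] with s hs
  have h1 : MemLp (fun x => f s x - f t x) 2 (volume.restrict Ω) := hs.sub ht
  have h2 : MemLp (fun x => (s - t)⁻¹ • (f s x - f t x)) 2 (volume.restrict Ω) :=
    h1.const_smul (s - t)⁻¹
  have h3 : MemLp (fun x => (s - t)⁻¹ • (f s x - f t x) - f' x) 2 (volume.restrict Ω) := h2.sub hf'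
  rw [← norm_sq_toL2 h3, Real.sqrt_sq (norm_nonneg _), toL2_sub h2 hf', toL2_smul _ h1,
    toL2_sub hs ht]
  rfl

/-! ### Fields concentrating at a point -/

/-- The factor between the amplitude and the `L²` norm of a field concentrating at a point. -/
def concNorm : ℝ := √(volume.real (Metric.ball (0 : Plane) 1))

theorem concNorm_nonneg : 0 ≤ concNorm := Real.sqrt_nonneg _

/-- Squared amplitude `(C / η)²` times the area of a disc of radius `η`: in dimension two the powers
of `η` cancel. -/
theorem norm_toL2_le_of_concentrated {c : Plane} {C η : ℝ} (hη : 0 < η)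
    (hC : ∀ x, ‖f x‖ ≤ C / η) (hs : ∀ x, η < ‖x - c‖ → f x = 0) :
    ‖toL2 Ω f‖ ≤ C * concNorm := by
  have hC0 : 0 ≤ C := by
    have := (norm_nonneg _).trans (hC 0)
    rwa [le_div_iff₀ hη, zero_mul] at this
  by_cases h : MemLp f 2 (volume.restrict Ω)
  swap
  · rw [toL2, dif_neg h, norm_zero]
    exact mul_nonneg hC0 concNorm_nonneg
  refine abs_le_of_sq_le_sq' ?_ (mul_nonneg hC0 concNorm_nonneg) |>.2
  rw [norm_sq_toL2 h, mul_pow, concNorm, Real.sq_sqrt measureReal_nonneg]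
  have hB : volume (Metric.closedBall c η) ≠ ⊤ := measure_closedBall_lt_top.ne
  calc ∫ x in Ω, ‖f x‖ ^ 2
      ≤ ∫ x in Ω, (Metric.closedBall c η).indicator (fun _ => (C / η) ^ 2) x := by
        refine integral_mono ((memLp_two_iff_integrable_sq_norm h.1).1 h) ?_ fun x => ?_
        · refine Integrable.mono_measure ?_ Measure.restrict_le_self
          exact (integrable_indicator_iff Metric.isClosed_closedBall.measurableSet).2
            (integrableOn_const hB)
        · by_cases hx : x ∈ Metric.closedBall c η
          · simp only [indicator_of_mem hx]
            gcongr
            exact hC x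
          · rw [mem_closedBall_iff_norm, not_le] at hx
            have : x ∉ Metric.closedBall c η := by rwa [mem_closedBall_iff_norm, not_le]
            simp [hs x hx, indicator_of_notMem this]
    _ ≤ ∫ x, (Metric.closedBall c η).indicator (fun _ => (C / η) ^ 2) x := by
        refine setIntegral_le_integral ?_ (ae_of_all _ fun x => ?_)
        · exact (integrable_indicator_iff Metric.isClosed_closedBall.measurableSet).2
            (integrableOn_const hB)
        · exact indicator_nonneg (fun _ _ => by positivity) x
    _ = C ^ 2 * volume.real (Metric.ball (0 : Plane) 1) := by
        rw [integral_indicator Metric.isClosed_closedBall.measurableSet, setIntegral_const,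
          Measure.addHaar_real_closedBall _ _ hη.le]
        simp only [finrank_euclideanSpace, Fintype.card_fin, smul_eq_mul]
        field_simp

/-- Only the restriction of `v` to the disc of radius `η` is seen by the inner product. Its `L²`
norm tends to zero, and Cauchy–Schwarz with the uniform bound on `f η` concludes. -/
theorem tendsto_inner_toL2_of_concentrated {f : ℝ → Plane → Plane} {c : Plane} {C : ℝ}
    (hmem : ∀ᶠ η in 𝓝[>] (0 : ℝ), MemLp (f η) 2 (volume.restrict Ω))
    (hC : ∀ᶠ η in 𝓝[>] (0 : ℝ), ∀ x, ‖f η x‖ ≤ C / η)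
    (hs : ∀ᶠ η in 𝓝[>] (0 : ℝ), ∀ x, η < ‖x - c‖ → f η x = 0) (v : L2 Ω) :
    Tendsto (fun η => inner ℝ (toL2 Ω (f η)) v) (𝓝[>] (0 : ℝ)) (𝓝 0) := by
  have hv : MemLp v 2 (volume.restrict Ω) := Lp.memLp v
  have hvi : ∀ η : ℝ, MemLp ((Metric.closedBall c η).indicator v) 2 (volume.restrict Ω) := fun η =>
    hv.indicator Metric.isClosed_closedBall.measurableSet
  have key : Tendsto (fun η : ℝ => ∫ x in Ω, ‖(Metric.closedBall c η).indicator v x‖ ^ 2)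
      (𝓝[>] (0 : ℝ)) (𝓝 (∫ _ in Ω, (0 : ℝ))) := by
    refine tendsto_integral_filter_of_dominated_convergence (fun x => ‖v x‖ ^ 2)
      (Eventually.of_forall fun η => (hvi η).1.norm.pow 2) (Eventually.of_forall fun η => ?_)
      ((memLp_two_iff_integrable_sq_norm hv.1).1 hv) ?_
    · refine ae_of_all _ fun x => ?_
      rw [norm_pow, norm_norm]
      gcongr
      exact norm_indicator_le_norm_self _ _
    · have hne : ∀ᵐ x ∂(volume.restrict Ω), x ≠ c :=
        ae_restrict_of_ae (Measure.ae_ne volume c)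
      filter_upwards [hne] with x hx
      refine tendsto_const_nhds.congr' ?_
      have : Iio ‖x - c‖ ∈ 𝓝 (0 : ℝ) := Iio_mem_nhds (norm_pos_iff.2 (sub_ne_zero.2 hx))
      filter_upwards [mem_nhdsWithin_of_mem_nhds this] with η hη
      rw [indicator_of_notMem, norm_zero, zero_pow two_ne_zero]
      rw [mem_closedBall_iff_norm, not_le]
      exact hη
  rw [integral_zero] at key
  have key' := (key.sqrt.const_mul (C * concNorm))
  rw [Real.sqrt_zero, mul_zero] at key'
  refine squeeze_zero_norm' ?_ key'
  filter_upwards [hmem, hC, hs, self_mem_nhdsWithin] with η h1 h2 h3 hη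
  have e : inner ℝ (toL2 Ω (f η)) v =
      inner ℝ (toL2 Ω (f η)) (toL2 Ω ((Metric.closedBall c η).indicator v)) := by
    rw [inner_toL2 _ (hvi η), L2.inner_def]
    refine integral_congr_ae ?_
    filter_upwards [toL2_coe h1] with x hx
    by_cases hxB : x ∈ Metric.closedBall c η
    · rw [indicator_of_mem hxB]
    · have : η < ‖x - c‖ := by rwa [mem_closedBall_iff_norm, not_le] at hxB
      rw [hx, h3 x this, inner_zero_left, inner_zero_left]
  rw [e, ← norm_sq_toL2 (hvi η), Real.sqrt_sq (norm_nonneg _)]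
  refine (norm_inner_le_norm _ _).trans ?_
  gcongr
  exact norm_toL2_le_of_concentrated hη h2 h3

end L2

/-! ### Lipschitz functions of time -/

section Time

variable {X : Type*} [NormedAddCommGroup X] [NormedSpace ℝ X]

/-- Translation invariance makes the integral of every forward difference quotient zero. These
quotients are bounded by `C`, live on the 1-neighbourhood of the support for steps at most `1`, and
converge almost everywhere to `g'`. -/
theorem integral_deriv_eq_zero_of_lipschitz {g g' : ℝ → X} {C : ℝ}
    (hlip : ∀ s t, ‖g s - g t‖ ≤ C * |s - t|) (hc : HasCompactSupport g)
    (hd : ∀ᵐ t, HasDerivAt g (g' t) t) : ∫ t, g' t = 0 := by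
  have hC0 : 0 ≤ C := by simpa using (norm_nonneg _).trans (hlip 1 0)
  have hcont : Continuous g := by
    have : LipschitzWith C.toNNReal g := LipschitzWith.of_dist_le_mul fun s t => by
      rw [dist_eq_norm, Real.dist_eq, Real.coe_toNNReal C hC0]
      exact hlip s t
    exact this.continuous
  have hint : Integrable g := hcont.integrable_of_hasCompactSupport hc
  set ε : ℕ → ℝ := fun n => 1 / ((n : ℝ) + 1) with hε
  have hε0 : ∀ n, 0 < ε n := fun n => Nat.one_div_pos_of_nat
  have hε1 : ∀ n, ε n ≤ 1 := fun n => by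
    rw [hε]; simp only
    rw [div_le_one (by positivity)]
    linarith [(Nat.cast_nonneg n : (0 : ℝ) ≤ n)]
  have h0 : ∀ n, ∫ t, (ε n)⁻¹ • (g (t + ε n) - g t) = 0 := fun n => by
    rw [integral_smul, integral_sub (hint.comp_add_right (ε n)) hint, integral_add_right_eq_self,
      sub_self, smul_zero]
  set K : Set ℝ := Metric.cthickening 1 (tsupport g)
  have hK : IsCompact K := hc.isCompact.cthickening
  have hlim : Tendsto (fun n => ∫ t, (ε n)⁻¹ • (g (t + ε n) - g t)) atTop (𝓝 (∫ t, g' t)) := by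
    refine tendsto_integral_of_dominated_convergence (K.indicator fun _ => C) (fun n => ?_)
      ((integrable_indicator_iff hK.isClosed.measurableSet).2
        (integrableOn_const hK.measure_lt_top.ne)) (fun n => ae_of_all _ fun t => ?_) ?_
    · exact (by fun_prop : Continuous fun t => (ε n)⁻¹ • (g (t + ε n) - g t)).aestronglyMeasurable
    · by_cases ht : t ∈ K
      · rw [indicator_of_mem ht, norm_smul, norm_inv, Real.norm_eq_abs, abs_of_pos (hε0 n),
          inv_mul_le_iff₀ (hε0 n)]
        have := hlip (t + ε n) t
        rw [add_sub_cancel_left, abs_of_pos (hε0 n)] at this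
        linarith
      · have h1 : g t = 0 := image_eq_zero_of_notMem_tsupport fun h =>
          ht (Metric.self_subset_cthickening _ h)
        have h2 : g (t + ε n) = 0 := image_eq_zero_of_notMem_tsupport fun h =>
          ht (Metric.mem_cthickening_of_dist_le _ _ _ _ h (by
            rw [Real.dist_eq, sub_add_cancel_left, abs_neg, abs_of_pos (hε0 n)]
            exact hε1 n))
        simp [h1, h2, indicator_of_notMem ht]
    · filter_upwards [hd] with t ht
      have h2 : Tendsto (fun n => t + ε n) atTop (𝓝[≠] t) := by
        refine tendsto_nhdsWithin_iff.2 ⟨?_, Eventually.of_forall fun n => ?_⟩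
        · simpa [hε] using (tendsto_one_div_add_atTop_nhds_zero_nat (𝕜 := ℝ)).const_add t
        · simpa using (hε0 n).ne'
      have := (hasDerivAt_iff_tendsto_slope.1 ht).comp h2
      refine this.congr fun n => ?_
      simp [slope_def_module]
  simp only [h0] at hlim
  exact tendsto_nhds_unique hlim tendsto_const_nhds |>.symm ▸ rfl

theorem weak_deriv_of_lipschitz {u u' : ℝ → X} {T C M : ℝ}
    (hlip : ∀ s ∈ Ioo 0 T, ∀ t ∈ Ioo 0 T, ‖u s - u t‖ ≤ C * |s - t|)
    (hM : ∀ t ∈ Ioo 0 T, ‖u t‖ ≤ M)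
    (hu' : AEStronglyMeasurable u' (volume.restrict (Ioo 0 T)))
    (hd : ∀ᵐ t ∂(volume.restrict (Ioo 0 T)), HasDerivAt u (u' t) t)
    {θ : ℝ → ℝ} (hθ : ContDiff ℝ ∞ θ) (hθc : HasCompactSupport θ) (hθs : tsupport θ ⊆ Ioo 0 T) :
    ∫ t in Ioo 0 T, deriv θ t • u t = -∫ t in Ioo 0 T, θ t • u' t := by
  obtain ⟨A, hA⟩ := hθc.exists_bound_of_continuous hθ.continuous
  have hdc : HasCompactSupport (deriv θ) := hθc.deriv
  have hdcont : Continuous (deriv θ) := hθ.continuous_deriv (by simp)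
  obtain ⟨B, hB⟩ := hdc.exists_bound_of_continuous hdcont
  have hθz : ∀ t, t ∉ Ioo 0 T → θ t = 0 := fun t ht =>
    image_eq_zero_of_notMem_tsupport fun h => ht (hθs h)
  have hA0 : 0 ≤ A := (norm_nonneg _).trans (hA 0)
  have hB0 : 0 ≤ B := (norm_nonneg _).trans (hB 0)
  have hθl : ∀ s t, |θ s - θ t| ≤ B * |s - t| := fun s t => by
    have := convex_univ.norm_image_sub_le_of_norm_deriv_le (f := θ) (C := B)
      (fun x _ => hθ.differentiable (by simp) x) (fun x _ => hB x) (mem_univ t) (mem_univ s)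
    simpa using this
  rcases (Ioo (0 : ℝ) T).eq_empty_or_nonempty with he | ⟨t₀, ht₀⟩
  · simp [he]
  have hM0 : 0 ≤ M := (norm_nonneg _).trans (hM t₀ ht₀)
  have hC0 : 0 ≤ C := by
    obtain ⟨t₁, ht₁⟩ := exists_between ht₀.2
    have h1 := (norm_nonneg _).trans (hlip t₁ ⟨ht₀.1.trans ht₁.1, ht₁.2⟩ t₀ ht₀)
    exact nonneg_of_mul_nonneg_left h1 (abs_pos.2 (sub_ne_zero.2 ht₁.1.ne'))
  -- Nothing is known about `u` outside `(0,T)`. If one of the times lies there, `θ` vanishes at it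
  -- and the Lipschitz bound of `θ` together with `‖u‖ ≤ M` at the other time suffices.
  have hgl : ∀ s t, ‖θ s • u s - θ t • u t‖ ≤ (B * M + A * C) * |s - t| := by
    intro s t
    have hle : B * M * |s - t| ≤ (B * M + A * C) * |s - t| := by
      gcongr
      linarith [mul_nonneg hA0 hC0]
    by_cases hs : s ∈ Ioo 0 T
    · by_cases ht : t ∈ Ioo 0 T
      · have e : θ s • u s - θ t • u t = (θ s - θ t) • u s + θ t • (u s - u t) := by module
        rw [e]
        refine (norm_add_le _ _).trans ?_
        rw [norm_smul, norm_smul, add_mul]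
        have h1 := mul_le_mul (hθl s t) (hM s hs) (norm_nonneg _) (by positivity)
        have h2 := mul_le_mul (hA t) (hlip s hs t ht) (norm_nonneg _) hA0
        rw [Real.norm_eq_abs (θ s - θ t)]
        linarith
      · refine le_trans ?_ hle
        have h1 := hθl s t
        rw [hθz t ht, sub_zero] at h1
        rw [hθz t ht, zero_smul, sub_zero, norm_smul, Real.norm_eq_abs]
        have := mul_le_mul h1 (hM s hs) (norm_nonneg _) (by positivity)
        linarith
    · by_cases ht : t ∈ Ioo 0 T
      · refine le_trans ?_ hle
        have h1 := hθl s t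
        rw [hθz s hs, zero_sub, abs_neg] at h1
        rw [hθz s hs, zero_smul, zero_sub, norm_neg, norm_smul, Real.norm_eq_abs]
        have := mul_le_mul h1 (hM t ht) (norm_nonneg _) (by positivity)
        linarith
      · rw [hθz s hs, hθz t ht, zero_smul, zero_smul, sub_zero, norm_zero]
        positivity
  have hgc : HasCompactSupport fun t => θ t • u t := hθc.smul_right
  set g' : ℝ → X := (Ioo 0 T).indicator fun t => deriv θ t • u t + θ t • u' t with hg'
  have hgd : ∀ᵐ t, HasDerivAt (fun t => θ t • u t) (g' t) t := by
    filter_upwards [(ae_restrict_iff' measurableSet_Ioo).1 hd] with t ht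
    by_cases hm : t ∈ Ioo 0 T
    · rw [hg', indicator_of_mem hm, add_comm]
      exact (hθ.differentiable (by simp) t).hasDerivAt.fun_smul (ht hm)
    · rw [hg', indicator_of_notMem hm]
      have : (fun t => θ t • u t) =ᶠ[𝓝 t] fun _ => 0 := by
        have h1 : (tsupport θ)ᶜ ∈ 𝓝 t :=
          (isClosed_tsupport θ).isOpen_compl.mem_nhds fun h => hm (hθs h)
        filter_upwards [h1] with s hs
        rw [image_eq_zero_of_notMem_tsupport hs, zero_smul]
      exact (hasDerivAt_const t (0 : X)).congr_of_eventuallyEq this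
  have h0 := integral_deriv_eq_zero_of_lipschitz hgl hgc hgd
  rw [hg', integral_indicator measurableSet_Ioo] at h0
  have hucont : ContinuousOn u (Ioo 0 T) := by
    have : LipschitzOnWith C.toNNReal u (Ioo 0 T) := LipschitzOnWith.of_dist_le_mul fun s hs t ht => by
      rw [dist_eq_norm, Real.dist_eq, Real.coe_toNNReal C hC0]
      exact hlip s hs t ht
    exact this.continuousOn
  have hu'b : ∀ᵐ t ∂(volume.restrict (Ioo 0 T)), ‖u' t‖ ≤ C := by
    filter_upwards [hd, ae_restrict_mem measurableSet_Ioo] with t ht hm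
    refine ht.le_of_lip' hC0 ?_
    filter_upwards [isOpen_Ioo.mem_nhds hm] with s hs
    exact hlip s hs t hm
  rw [integral_add] at h0
  · exact eq_neg_of_add_eq_zero_left h0
  · refine Integrable.of_bound
      ((hdcont.continuousOn.smul hucont).aestronglyMeasurable measurableSet_Ioo) (B * M) ?_
    filter_upwards [ae_restrict_mem measurableSet_Ioo] with t hm
    rw [norm_smul]
    exact mul_le_mul (hB t) (hM t hm) (norm_nonneg _) hB0
  · refine Integrable.of_bound
      (hθ.continuous.aestronglyMeasurable.smul hu') (A * C) ?_
    filter_upwards [hu'b] with t ht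
    rw [norm_smul]
    exact mul_le_mul (hA t) ht (norm_nonneg _) hA0

/-- A differentiable curve in a closed subspace is differentiable as a curve in the subspace. -/
theorem hasDerivAt_codRestrict {S : Submodule ℝ X} (hS : IsClosed (S : Set X)) {f : ℝ → S}
    {v : X} {t : ℝ} (h : HasDerivAt (fun s => (f s : X)) v t) :
    ∃ hv : v ∈ S, HasDerivAt f ⟨v, hv⟩ t := by
  have hsl := hasDerivAt_iff_tendsto_slope.1 h
  have e : ∀ s, slope (fun s => (f s : X)) t s = (slope f t s : S) := fun s => by
    simp [slope_def_module]
  have hv : v ∈ S := hS.mem_of_tendsto hsl (Eventually.of_forall fun s => by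
    rw [e]; exact (slope f t s).2)
  refine ⟨hv, hasDerivAt_iff_tendsto_slope.2 (tendsto_subtype_rng.2 ?_)⟩
  exact hsl.congr e

end Time

/-! ### Smooth fields as elements of `H¹` -/

section Jets

variable {Ω : Set Plane} {f g : Plane → Plane}

theorem SmoothCompact.differentiable (hf : SmoothCompact f) : Differentiable ℝ f :=
  hf.1.differentiable (by simp)

theorem SmoothCompact.sub (hf : SmoothCompact f) (hg : SmoothCompact g) :
    SmoothCompact fun x => f x - g x := ⟨hf.1.sub hg.1, hf.2.sub hg.2⟩

theorem SmoothCompact.sum {ι : Type*} (s : Finset ι) {f : ι → Plane → Plane}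
    (hf : ∀ i, SmoothCompact (f i)) : SmoothCompact fun x => ∑ i ∈ s, f i x := by
  classical
  refine ⟨ContDiff.sum fun i _ => (hf i).1, ?_⟩
  induction s using Finset.induction_on with
  | empty => simpa using! HasCompactSupport.zero
  | insert i s hi ih =>
    simp only [Finset.sum_insert hi]
    exact (hf i).2.add ih

theorem partialDeriv_sub (hf : Differentiable ℝ f) (hg : Differentiable ℝ g) (j : Fin 2)
    (x : Plane) :
    partialDeriv j (fun x => f x - g x) x = partialDeriv j f x - partialDeriv j g x := by
  simp [partialDeriv, fderiv_fun_sub (hf x) (hg x)]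

theorem partialDeriv_sum {ι : Type*} (s : Finset ι) {f : ι → Plane → Plane}
    (hf : ∀ i, Differentiable ℝ (f i)) (j : Fin 2) (x : Plane) :
    partialDeriv j (fun x => ∑ i ∈ s, f i x) x = ∑ i ∈ s, partialDeriv j (f i) x := by
  simp [partialDeriv, fderiv_fun_sum fun i _ => hf i x]

theorem toH1_coe (hf : SmoothCompact f) : (toH1 Ω f : Jet Ω) = smoothJet Ω f := by
  rw [toH1, dif_pos hf]

theorem fieldOf_toH1 (hf : SmoothCompact f) : fieldOf (toH1 Ω f) = toL2 Ω f := by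
  rw [fieldOf, toH1_coe hf]
  rfl

theorem weakPartial_toH1 (hf : SmoothCompact f) (j : Fin 2) :
    weakPartial (toH1 Ω f) j = toL2 Ω (partialDeriv j f) := by
  rw [weakPartial, toH1_coe hf]
  rfl

theorem inner_h1 (v w : H1 Ω) :
    inner ℝ v w = inner ℝ (fieldOf v) (fieldOf w) +
      ∑ j, inner ℝ (weakPartial v j) (weakPartial w j) := by
  rw [Submodule.coe_inner, WithLp.prod_inner_apply, PiLp.inner_apply]
  rfl

theorem norm_h1_le (w : H1 Ω) :
    ‖w‖ ≤ ‖fieldOf w‖ + ‖weakPartial w 0‖ + ‖weakPartial w 1‖ := by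
  refine abs_le_of_sq_le_sq' ?_ (by positivity) |>.2
  rw [← real_inner_self_eq_norm_sq, inner_h1, Fin.sum_univ_two, real_inner_self_eq_norm_sq,
    real_inner_self_eq_norm_sq, real_inner_self_eq_norm_sq]
  nlinarith [norm_nonneg (fieldOf w), norm_nonneg (weakPartial w 0), norm_nonneg (weakPartial w 1),
    mul_nonneg (norm_nonneg (fieldOf w)) (norm_nonneg (weakPartial w 0)),
    mul_nonneg (norm_nonneg (fieldOf w)) (norm_nonneg (weakPartial w 1)),
    mul_nonneg (norm_nonneg (weakPartial w 0)) (norm_nonneg (weakPartial w 1))]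

theorem norm_toH1_le (hf : SmoothCompact f) {C : ℝ} (h0 : ‖toL2 Ω f‖ ≤ C)
    (h1 : ∀ j, ‖toL2 Ω (partialDeriv j f)‖ ≤ C) : ‖toH1 Ω f‖ ≤ 3 * C := by
  refine (norm_h1_le _).trans ?_
  rw [fieldOf_toH1 hf, weakPartial_toH1 hf, weakPartial_toH1 hf]
  linarith [h1 0, h1 1]

theorem toH1_sub (hf : SmoothCompact f) (hg : SmoothCompact g) :
    toH1 Ω (fun x => f x - g x) = toH1 Ω f - toH1 Ω g := by
  refine Subtype.ext ?_
  rw [AddSubgroupClass.coe_sub, toH1_coe hf, toH1_coe hg, toH1_coe (hf.sub hg)]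
  have h : ∀ j, toL2 Ω (partialDeriv j fun x => f x - g x) =
      toL2 Ω (partialDeriv j f) - toL2 Ω (partialDeriv j g) := fun j => by
    rw [← toL2_sub ((hf.partialDeriv j).memLp Ω) ((hg.partialDeriv j).memLp Ω)]
    congr 1
    exact funext fun x => partialDeriv_sub hf.differentiable hg.differentiable j x
  simp only [smoothJet, toL2_sub (hf.memLp Ω) (hg.memLp Ω), h]
  rfl

theorem toH1_zero : toH1 Ω (fun _ => 0) = 0 := by
  have h : SmoothCompact fun _ : Plane => (0 : Plane) := ⟨contDiff_const, HasCompactSupport.zero⟩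
  simpa using toH1_sub (Ω := Ω) h h

theorem toH1_sum {ι : Type*} (s : Finset ι) {f : ι → Plane → Plane}
    (hf : ∀ i, SmoothCompact (f i)) :
    toH1 Ω (fun x => ∑ i ∈ s, f i x) = ∑ i ∈ s, toH1 Ω (f i) := by
  classical
  induction s using Finset.induction_on with
  | empty => simpa using toH1_zero
  | insert i s hi ih =>
    have h : SmoothCompact fun x => ∑ i ∈ insert i s, f i x := SmoothCompact.sum _ hf
    rw [Finset.sum_insert hi, ← ih, ← sub_eq_iff_eq_add, ← toH1_sub h (SmoothCompact.sum s hf)]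
    simp only [Finset.sum_insert hi, add_sub_cancel_right]

theorem weakDiv_toH1 (hf : SmoothCompact f) :
    weakDiv (toH1 Ω f) =ᵐ[volume.restrict Ω] divergence f := by
  have h : ∀ j, weakPartial (toH1 Ω f) j =ᵐ[volume.restrict Ω] partialDeriv j f := fun j => by
    rw [weakPartial_toH1 hf]
    exact toL2_coe ((hf.partialDeriv j).memLp Ω)
  filter_upwards [h 0, h 1] with x h0 h1
  simp only [weakDiv, divergence, Fin.sum_univ_two, h0, h1]

theorem toH1_mem_H10 (hf : IsTest Ω f) : toH1 Ω f ∈ H10 Ω :=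
  Submodule.le_topologicalClosure _ (Submodule.subset_span ⟨f, hf, rfl⟩)

end Jets

/-! ### Lipschitz families of smooth fields -/

/-- A family of smooth compactly supported fields which, together with its first partial
derivatives, is Lipschitz in time on `[0,T)` and differentiable at the times in `S`. -/
structure TimeField (T : ℝ) (S : Set ℝ) (L : ℝ) (u : ℝ → Plane → Plane) : Prop where
  smooth : ∀ t ∈ Ico 0 T, SmoothCompact (u t)
  lip : ∀ s ∈ Ico 0 T, ∀ t ∈ Ico 0 T, ∀ x, ‖u s x - u t x‖ ≤ L * |s - t|
  lip_partial : ∀ s ∈ Ico 0 T, ∀ t ∈ Ico 0 T, ∀ j x,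
    ‖partialDeriv j (u s) x - partialDeriv j (u t) x‖ ≤ L * |s - t|
  diff : ∀ t ∈ S, ∀ x, DifferentiableAt ℝ (fun s => u s x) t
  diff_partial : ∀ t ∈ S, ∀ j x, DifferentiableAt ℝ (fun s => partialDeriv j (u s) x) t

/-- The pointwise time derivative of a family of fields. -/
def timeDeriv (u : ℝ → Plane → Plane) (t : ℝ) (x : Plane) : Plane := deriv (fun s => u s x) t

namespace TimeField

variable {Ω : Set Plane} {T L L' : ℝ} {S S' : Set ℝ} {u v : ℝ → Plane → Plane}

theorem mono (hu : TimeField T S L u) (hS : S' ⊆ S) : TimeField T S' L u :=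
  ⟨hu.smooth, hu.lip, hu.lip_partial, fun t ht => hu.diff t (hS ht),
    fun t ht => hu.diff_partial t (hS ht)⟩

theorem sub (hS : S ⊆ Ioo 0 T) (hu : TimeField T S L u) (hv : TimeField T S L' v) :
    TimeField T S (L + L') fun t x => u t x - v t x where
  smooth t ht := (hu.smooth t ht).sub (hv.smooth t ht)
  lip s hs t ht x := by
    rw [sub_sub_sub_comm, add_mul]
    exact (norm_sub_le _ _).trans (add_le_add (hu.lip s hs t ht x) (hv.lip s hs t ht x))
  lip_partial s hs t ht j x := by
    rw [partialDeriv_sub (hu.smooth s hs).differentiable (hv.smooth s hs).differentiable,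
      partialDeriv_sub (hu.smooth t ht).differentiable (hv.smooth t ht).differentiable,
      sub_sub_sub_comm, add_mul]
    exact (norm_sub_le _ _).trans
      (add_le_add (hu.lip_partial s hs t ht j x) (hv.lip_partial s hs t ht j x))
  diff t ht x := (hu.diff t ht x).sub (hv.diff t ht x)
  diff_partial t ht j x := by
    refine ((hu.diff_partial t ht j x).sub (hv.diff_partial t ht j x)).congr_of_eventuallyEq ?_
    filter_upwards [Ico_mem_nhds (hS ht).1 (hS ht).2] with s hs
    exact partialDeriv_sub (hu.smooth s hs).differentiable (hv.smooth s hs).differentiable j x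

theorem sum {ι : Type*} [Fintype ι] (hS : S ⊆ Ioo 0 T) {L : ι → ℝ}
    {u : ι → ℝ → Plane → Plane} (hu : ∀ i, TimeField T S (L i) (u i)) :
    TimeField T S (∑ i, L i) fun t x => ∑ i, u i t x where
  smooth t ht := SmoothCompact.sum _ fun i => (hu i).smooth t ht
  lip s hs t ht x := by
    rw [← Finset.sum_sub_distrib]
    refine (norm_sum_le_of_le _ fun i _ => (hu i).lip s hs t ht x).trans ?_
    rw [Finset.sum_mul]
  lip_partial s hs t ht j x := by
    rw [partialDeriv_sum _ fun i => ((hu i).smooth s hs).differentiable,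
      partialDeriv_sum _ fun i => ((hu i).smooth t ht).differentiable, ← Finset.sum_sub_distrib]
    refine (norm_sum_le_of_le _ fun i _ => (hu i).lip_partial s hs t ht j x).trans ?_
    rw [Finset.sum_mul]
  diff t ht x := DifferentiableAt.fun_sum fun i _ => (hu i).diff t ht x
  diff_partial t ht j x := by
    refine (DifferentiableAt.fun_sum (u := Finset.univ)
      fun i _ => (hu i).diff_partial t ht j x).congr_of_eventuallyEq ?_
    filter_upwards [Ico_mem_nhds (hS ht).1 (hS ht).2] with s hs
    exact partialDeriv_sum _ (fun i => ((hu i).smooth s hs).differentiable) j x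

theorem norm_toH1_sub_le [IsFiniteMeasure (volume.restrict Ω)] (hu : TimeField T S L u) {s t : ℝ}
    (hs : s ∈ Ico 0 T) (ht : t ∈ Ico 0 T) :
    ‖toH1 Ω (u s) - toH1 Ω (u t)‖ ≤ 3 * (supToL2 Ω * L) * |s - t| := by
  rw [← toH1_sub (hu.smooth s hs) (hu.smooth t ht), mul_assoc, mul_assoc]
  refine norm_toH1_le ((hu.smooth s hs).sub (hu.smooth t ht)) (norm_toL2_le (hu.lip s hs t ht))
    fun j => norm_toL2_le fun x => ?_
  rw [partialDeriv_sub (hu.smooth s hs).differentiable (hu.smooth t ht).differentiable]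
  exact hu.lip_partial s hs t ht j x

theorem hasDerivAt_toL2 [IsFiniteMeasure (volume.restrict Ω)] (hS : S ⊆ Ioo 0 T)
    (hu : TimeField T S L u) {t : ℝ} (ht : t ∈ S) :
    MemLp (timeDeriv u t) 2 (volume.restrict Ω) ∧ (∀ x, ‖timeDeriv u t x‖ ≤ L) ∧
      HasDerivAt (fun s => toL2 Ω (u s)) (toL2 Ω (timeDeriv u t)) t := by
  have hm : Ico 0 T ∈ 𝓝 t := Ico_mem_nhds (hS ht).1 (hS ht).2
  have htT : t ∈ Ico 0 T := Ioo_subset_Ico_self (hS ht)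
  refine Fluid.hasDerivAt_toL2 ?_ ?_ fun x => (hu.diff t ht x).hasDerivAt
  · filter_upwards [hm] with s hs using (hu.smooth s hs).memLp Ω
  · filter_upwards [hm] with s hs using hu.lip s hs t htT

/-- Field and partial derivatives are differentiated in time separately, as components of a jet.
Because `H¹` is closed among jets, the derivative is again in `H¹`, with no exchange of space and
time derivatives. -/
theorem exists_hasDerivAt_toH1 [IsFiniteMeasure (volume.restrict Ω)] (hS : S ⊆ Ioo 0 T)
    (hu : TimeField T S L u) {t : ℝ} (ht : t ∈ S) :
    ∃ w : H1 Ω, HasDerivAt (fun s => toH1 Ω (u s)) w t ∧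
      fieldOf w = toL2 Ω (timeDeriv u t) := by
  have hm : Ico 0 T ∈ 𝓝 t := Ico_mem_nhds (hS ht).1 (hS ht).2
  have htT : t ∈ Ico 0 T := Ioo_subset_Ico_self (hS ht)
  have h0 := (hu.hasDerivAt_toL2 (Ω := Ω) hS ht).2.2
  have h1 : ∀ j, HasDerivAt (fun s => toL2 Ω (partialDeriv j (u s)))
      (toL2 Ω fun x => deriv (fun s => partialDeriv j (u s) x) t) t := fun j => by
    refine (Fluid.hasDerivAt_toL2 (L := L) ?_ ?_
      fun x => (hu.diff_partial t ht j x).hasDerivAt).2.2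
    · filter_upwards [hm] with s hs using ((hu.smooth s hs).partialDeriv j).memLp Ω
    · filter_upwards [hm] with s hs using fun x => hu.lip_partial s hs t htT j x
  have h2 := (PiLp.continuousLinearEquiv 2 ℝ (fun _ : Fin 2 => L2 Ω)).symm.hasFDerivAt.comp_hasDerivAt
    t (hasDerivAt_pi.2 h1)
  have h3 := (WithLp.prodContinuousLinearEquiv 2 ℝ (L2 Ω)
    (PiLp 2 fun _ : Fin 2 => L2 Ω)).symm.hasFDerivAt.comp_hasDerivAt t (h0.prodMk h2)
  have h4 : HasDerivAt (fun s => (toH1 Ω (u s) : Jet Ω)) _ t := h3.congr_of_eventuallyEq (by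
    filter_upwards [hm] with s hs
    rw [toH1_coe (hu.smooth s hs)]
    rfl)
  obtain ⟨hv, hd⟩ := hasDerivAt_codRestrict (H1.isClosed Ω) h4
  exact ⟨_, hd, rfl⟩

end TimeField

/-! ### Lipschitz curves of test fields as elements of `W^{1,∞}_c([0,T); H¹₀)` -/

/-- A smooth compactly supported field in `Ω` as an element of `H¹₀(Ω)` (zero for fields which are
not in `H¹₀(Ω)`). -/
def toH10 (Ω : Set Plane) (f : Plane → Plane) : H10 Ω :=
  open Classical in if h : toH1 Ω f ∈ H10 Ω then ⟨toH1 Ω f, h⟩ else 0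

theorem toH10_coe {Ω : Set Plane} {f : Plane → Plane} (hf : IsTest Ω f) :
    (toH10 Ω f : H1 Ω) = toH1 Ω f := by
  rw [toH10, dif_pos (toH1_mem_H10 hf)]

theorem continuousOn_of_norm_sub_le {X : Type*} [NormedAddCommGroup X] {f : ℝ → X} {s : Set ℝ}
    {C : ℝ} (h : ∀ a ∈ s, ∀ b ∈ s, ‖f a - f b‖ ≤ C * |a - b|) : ContinuousOn f s := by
  have : LipschitzOnWith C.toNNReal f s := LipschitzOnWith.of_dist_le_mul fun a ha b hb => by
    rw [dist_eq_norm, Real.dist_eq]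
    exact (h a ha b hb).trans (mul_le_mul_of_nonneg_right (Real.le_coe_toNNReal C) (abs_nonneg _))
  exact this.continuousOn

theorem memLp_top_of_norm_sub_le {X : Type*} [NormedAddCommGroup X] {f : ℝ → X} {T C : ℝ}
    (h : ∀ a ∈ Ico 0 T, ∀ b ∈ Ico 0 T, ‖f a - f b‖ ≤ C * |a - b|) :
    MemLp f ⊤ (volume.restrict (Ioo 0 T)) := by
  have hc := (continuousOn_of_norm_sub_le h).mono Ioo_subset_Ico_self
  refine memLp_top_of_bound (hc.aestronglyMeasurable measurableSet_Ioo) (‖f 0‖ + |C| * T) ?_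
  filter_upwards [ae_restrict_mem measurableSet_Ioo] with t ht
  have h1 := h t (Ioo_subset_Ico_self ht) 0 ⟨le_rfl, ht.1.trans ht.2⟩
  have h2 : C * |t - 0| ≤ |C| * T := by
    rw [sub_zero, abs_of_pos ht.1]
    exact mul_le_mul (le_abs_self C) ht.2.le ht.1.le (abs_nonneg C)
  have h3 := norm_sub_norm_le (f t) (f 0)
  linarith

theorem exists_isW1InftyC {E : Type*} [NormedAddCommGroup E] [NormedSpace ℝ E] [CompleteSpace E]
    {V : Submodule ℝ E} (hV : IsClosed (V : Set E)) {U : ℝ → V} {w : ℝ → E} {T C : ℝ} {S : Set ℝ}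
    (hS : S ⊆ Ioo 0 T) (hSae : ∀ᵐ t ∂(volume.restrict (Ioo 0 T)), t ∈ S)
    (hlip : ∀ s ∈ Ico 0 T, ∀ t ∈ Ico 0 T, ‖(U s : E) - U t‖ ≤ C * |s - t|)
    (hd : ∀ t ∈ S, HasDerivAt (fun s => (U s : E)) (w t) t)
    (hτ : ∃ τ < T, ∀ t ∈ Ico 0 T, τ ≤ t → U t = 0) :
    ∃ dU : ℝ → V, IsW1InftyC T U dU ∧ ∀ t ∈ S, (dU t : E) = w t := by
  have : CompleteSpace V := hV.completeSpace_coe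
  have hl : ∀ s ∈ Ico 0 T, ∀ t ∈ Ico 0 T, ‖U s - U t‖ ≤ C * |s - t| := hlip
  have hU : ∀ t ∈ S, HasDerivAt U (deriv U t) t ∧ ((deriv U t : V) : E) = w t := fun t ht => by
    obtain ⟨hv, h⟩ := hasDerivAt_codRestrict hV (hd t ht)
    rw [h.deriv]
    exact ⟨h, rfl⟩
  have hlI : ∀ s ∈ Ioo 0 T, ∀ t ∈ Ioo 0 T, ‖U s - U t‖ ≤ C * |s - t| := fun s hs t ht =>
    hl s (Ioo_subset_Ico_self hs) t (Ioo_subset_Ico_self ht)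
  -- The total function `deriv U` serves as weak derivative: it is strongly measurable without
  -- further argument, and its default value `0` can only occur off the set `S` of full measure or
  -- where the derivative is truly zero.
  refine ⟨deriv U, ⟨memLp_top_of_norm_sub_le hl, ?_, fun θ h1 h2 h3 => ?_,
    continuousOn_of_norm_sub_le hl, hτ⟩, fun t ht => (hU t ht).2⟩
  · refine memLp_top_of_bound (aestronglyMeasurable_deriv _ _) |C| ?_
    filter_upwards [hSae] with t ht
    refine (hU t ht).1.le_of_lip' (abs_nonneg _) ?_
    filter_upwards [Ioo_mem_nhds (hS ht).1 (hS ht).2] with s hs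
    exact (hlI s hs t (hS ht)).trans (mul_le_mul_of_nonneg_right (le_abs_self _) (abs_nonneg _))
  · have hb : ∀ t ∈ Ioo 0 T, ‖U t‖ ≤ ‖U 0‖ + |C| * T := by
      intro t ht
      have h1 := hl t (Ioo_subset_Ico_self ht) 0 ⟨le_rfl, ht.1.trans ht.2⟩
      have h2 : C * |t - 0| ≤ |C| * T := by
        rw [sub_zero, abs_of_pos ht.1]
        exact mul_le_mul (le_abs_self _) ht.2.le ht.1.le (abs_nonneg _)
      have h3 := norm_sub_norm_le (U t) (U 0)
      linarith
    refine weak_deriv_of_lipschitz hlI hb (aestronglyMeasurable_deriv _ _) ?_ h1 h2 h3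
    filter_upwards [hSae] with t ht using (hU t ht).1

theorem TimeField.exists_isW1InftyC {Ω : Set Plane} {T L : ℝ} {S : Set ℝ}
    {u : ℝ → Plane → Plane} [IsFiniteMeasure (volume.restrict Ω)] (hS : S ⊆ Ioo 0 T)
    (hSae : ∀ᵐ t ∂(volume.restrict (Ioo 0 T)), t ∈ S) (hu : TimeField T S L u)
    (htest : ∀ t ∈ Ico 0 T, IsTest Ω (u t))
    (hτ : ∃ τ < T, ∀ t ∈ Ico 0 T, τ ≤ t → u t = fun _ => 0) :
    ∃ dU : ℝ → H10 Ω, IsW1InftyC T (fun t => toH10 Ω (u t)) dU ∧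
      ∀ t ∈ S, fieldOf (dU t : H1 Ω) = toL2 Ω (timeDeriv u t) := by
  choose! w hw hwf using fun t (ht : t ∈ S) => hu.exists_hasDerivAt_toH1 (Ω := Ω) hS ht
  have hcl : IsClosed (H10 Ω : Set (H1 Ω)) := Submodule.isClosed_topologicalClosure _
  obtain ⟨τ, hτT, hτ⟩ := hτ
  obtain ⟨dU, h1, h2⟩ := Fluid.exists_isW1InftyC hcl (U := fun t => toH10 Ω (u t)) (w := w)
    (C := 3 * (supToL2 Ω * L)) hS hSae (fun s hs t ht => by
      rw [toH10_coe (htest s hs), toH10_coe (htest t ht)]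
      exact hu.norm_toH1_sub_le hs ht) (fun t ht => (hw t ht).congr_of_eventuallyEq (by
        filter_upwards [Ico_mem_nhds (hS ht).1 (hS ht).2] with s hs
        exact toH10_coe (htest s hs)))
    ⟨τ, hτT, fun t ht hle => Subtype.ext (by
      rw [toH10_coe (htest t ht), hτ t ht hle, toH1_zero]
      rfl)⟩
  exact ⟨dU, h1, fun t ht => by rw [h2 t ht, hwf t ht]⟩

/-! ### Uniform bounds for space-time test fields -/

/-- A family of smooth compactly supported fields on `[0,T)` which is bounded and Lipschitz with
constant `M`, as are its first partial derivatives. -/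
structure TameField (T M : ℝ) (φ : ℝ → Plane → Plane) : Prop where
  smooth : ∀ t ∈ Ico 0 T, SmoothCompact (φ t)
  bound : ∀ t ∈ Ico 0 T, ∀ x, ‖φ t x‖ ≤ M
  bound_partial : ∀ t ∈ Ico 0 T, ∀ j x, ‖partialDeriv j (φ t) x‖ ≤ M
  lip : ∀ s ∈ Ico 0 T, ∀ t ∈ Ico 0 T, ∀ x y, ‖φ s x - φ t y‖ ≤ M * (|s - t| + ‖x - y‖)
  lip_partial : ∀ s ∈ Ico 0 T, ∀ t ∈ Ico 0 T, ∀ j x,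
    ‖partialDeriv j (φ s) x - partialDeriv j (φ t) x‖ ≤ M * |s - t|
  diff : ∀ t ∈ Ioo 0 T, ∀ x, DifferentiableAt ℝ (fun p : ℝ × Plane => φ p.1 p.2) (t, x)
  diff_partial : ∀ t ∈ Ioo 0 T, ∀ j x, DifferentiableAt ℝ (fun s => partialDeriv j (φ s) x) t

/-- `G` and its derivative are bounded on the compact `K` and vanish off it, and the slab is convex,
so the mean value inequality applies up to `t = 0`. The first conclusion allows the lemma to be
applied again to the space derivatives of `G`. -/
theorem exists_bound_and_lipschitz {F : Type*} [NormedAddCommGroup F] [NormedSpace ℝ F] {T : ℝ}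
    {G : ℝ × Plane → F} (hG : ContDiffOn ℝ ∞ G (Ico 0 T ×ˢ univ)) {K : Set (ℝ × Plane)}
    (hK : IsCompact K) (hKs : K ⊆ Ico 0 T ×ˢ univ) (hG0 : ∀ p ∈ Ico 0 T ×ˢ univ, p ∉ K → G p = 0) :
    (∀ p ∈ Ico 0 T ×ˢ univ, p ∉ K → fderivWithin ℝ G (Ico 0 T ×ˢ univ) p = 0) ∧
    ∃ M, (∀ p ∈ Ico 0 T ×ˢ univ, ‖G p‖ ≤ M) ∧
      ∀ p ∈ Ico 0 T ×ˢ univ, ∀ q ∈ Ico 0 T ×ˢ univ, ‖G p - G q‖ ≤ M * ‖p - q‖ := by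
  set D : Set (ℝ × Plane) := Ico 0 T ×ˢ univ
  have hD : UniqueDiffOn ℝ D := (uniqueDiffOn_Ico 0 T).prod uniqueDiffOn_univ
  have hDc : Convex ℝ D := (convex_Ico 0 T).prod convex_univ
  have h0 : ∀ p ∈ D, p ∉ K → fderivWithin ℝ G D p = 0 := fun p hp hpK => by
    have : G =ᶠ[𝓝[D] p] fun _ => 0 := by
      filter_upwards [self_mem_nhdsWithin,
        mem_nhdsWithin_of_mem_nhds (hK.isClosed.isOpen_compl.mem_nhds hpK)] with q h1 h2
      exact hG0 q h1 h2
    rw [this.fderivWithin_eq (hG0 p hp hpK)]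
    simp
  have hd : ContinuousOn (fderivWithin ℝ G D) D :=
    (hG.fderivWithin hD (m := ∞) (by simp)).continuousOn
  obtain ⟨A, hA⟩ := hK.exists_bound_of_continuousOn (hG.continuousOn.mono hKs)
  obtain ⟨B, hB⟩ := hK.exists_bound_of_continuousOn (hd.mono hKs)
  refine ⟨h0, |A| + |B|, fun p hp => ?_, fun p hp q hq => ?_⟩
  · by_cases hpK : p ∈ K
    · linarith [hA p hpK, le_abs_self A, abs_nonneg B]
    · rw [hG0 p hp hpK, norm_zero]
      positivity
  · refine hDc.norm_image_sub_le_of_norm_fderivWithin_le (hG.differentiableOn (by simp))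
      (fun r hr => ?_) hq hp
    by_cases hrK : r ∈ K
    · linarith [hB r hrK, le_abs_self B, abs_nonneg A]
    · rw [h0 r hr hrK, norm_zero]
      positivity

theorem IsSpaceTimeTest.exists_tameField {T : ℝ} {Ω : Set Plane} {φ : ℝ → Plane → Plane}
    (hφ : IsSpaceTimeTest T Ω φ) : ∃ M, 0 ≤ M ∧ TameField T M φ := by
  obtain ⟨K, hK, hKs, hK0⟩ := hφ.compact_support
  set D : Set (ℝ × Plane) := Ico 0 T ×ˢ univ with hDdef
  set G : ℝ × Plane → Plane := fun p => φ p.1 p.2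
  have hD : UniqueDiffOn ℝ D := (uniqueDiffOn_Ico 0 T).prod uniqueDiffOn_univ
  have hKD : K ⊆ D := hKs.trans (prod_mono_right (subset_univ _))
  have hmem : ∀ {t : ℝ} (x : Plane), t ∈ Ico 0 T → (t, x) ∈ D := fun x ht => ⟨ht, mem_univ x⟩
  have hnhds : ∀ {t : ℝ} (x : Plane), t ∈ Ioo 0 T → D ∈ 𝓝 (t, x) := fun x ht =>
    prod_mem_nhds (Ico_mem_nhds ht.1 ht.2) univ_mem
  have hG : ContDiffOn ℝ ∞ G D := hφ.contDiffOn
  obtain ⟨hG'0, A, hA, hAl⟩ := exists_bound_and_lipschitz hG hK hKD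
    fun p hp hpK => hK0 p.1 hp.1 p.2 hpK
  set H : Fin 2 → ℝ × Plane → Plane := fun j p => fderivWithin ℝ G D p (0, basisVec j) with hH
  have hHs : ∀ j, ContDiffOn ℝ ∞ (H j) D := fun j =>
    (hG.fderivWithin hD (m := ∞) (by simp)).clm_apply contDiffOn_const
  have hB : ∀ j, ∃ M, (∀ p ∈ D, ‖H j p‖ ≤ M) ∧ ∀ p ∈ D, ∀ q ∈ D, ‖H j p - H j q‖ ≤ M * ‖p - q‖ :=
    fun j => (exists_bound_and_lipschitz (hHs j) hK hKD
      fun p hp hpK => by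
        simp only [hH, hDdef, hG'0 p hp hpK, _root_.zero_apply]).2
  choose B hB hBl using hB
  have hpart : ∀ t ∈ Ico 0 T, ∀ j x, partialDeriv j (φ t) x = H j (t, x) := fun t ht j x => by
    have h1 : HasFDerivWithinAt G (fderivWithin ℝ G D (t, x)) D (t, x) :=
      (hG.differentiableOn (by simp) _ (hmem x ht)).hasFDerivWithinAt
    have h2 : HasFDerivWithinAt (fun y : Plane => (t, y)) (ContinuousLinearMap.inr ℝ ℝ Plane)
        univ x := (hasFDerivAt_prodMk_right t x).hasFDerivWithinAt
    have h3 := (h1.comp x h2 fun y _ => hmem y ht).hasFDerivAt univ_mem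
    have h4 : fderiv ℝ (φ t) x = _ := h3.fderiv
    simp [partialDeriv, h4, hH]
  set M : ℝ := |A| + ∑ j, |B j| with hM
  have hAM : A ≤ M := by
    have := Finset.sum_nonneg fun j (_ : j ∈ Finset.univ) => abs_nonneg (B j)
    linarith [le_abs_self A]
  have hBM : ∀ j, B j ≤ M := fun j => by
    have := Finset.single_le_sum (fun j _ => abs_nonneg (B j)) (Finset.mem_univ j)
    linarith [le_abs_self (B j), abs_nonneg A]
  have hnorm : ∀ (s t : ℝ) (x y : Plane), ‖((s, x) : ℝ × Plane) - (t, y)‖ ≤ |s - t| + ‖x - y‖ :=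
    fun s t x y => by
      rw [Prod.mk_sub_mk, Prod.norm_mk, Real.norm_eq_abs]
      exact max_le_add_of_nonneg (abs_nonneg _) (norm_nonneg _)
  have hM0 : 0 ≤ M := by positivity
  refine ⟨M, hM0, fun t ht => ⟨?_, ?_⟩, fun t ht x => (hA _ (hmem x ht)).trans hAM,
    fun t ht j x => ?_, fun s hs t ht x y => ?_, fun s hs t ht j x => ?_, fun t ht x => ?_,
    fun t ht j x => ?_⟩
  · rw [← contDiffOn_univ]
    exact hG.comp (contDiff_prodMk_right t).contDiffOn fun x _ => hmem x ht
  · refine HasCompactSupport.intro (hK.image continuous_snd) fun x hx => hK0 t ht x fun h => hx ?_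
    exact ⟨_, h, rfl⟩
  · rw [hpart t ht]
    exact (hB j _ (hmem x ht)).trans (hBM j)
  · refine (hAl (s, x) (hmem x hs) (t, y) (hmem y ht)).trans ?_
    exact mul_le_mul hAM (hnorm s t x y) (norm_nonneg _) hM0
  · rw [hpart t ht, hpart s hs]
    refine (hBl j (s, x) (hmem x hs) (t, x) (hmem x ht)).trans ?_
    refine mul_le_mul (hBM j) ((hnorm s t x x).trans ?_) (norm_nonneg _) hM0
    simp
  · exact (hG.differentiableOn (by simp)).differentiableAt (hnhds x ht)
  · have h1 : DifferentiableAt ℝ (H j) (t, x) :=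
      ((hHs j).differentiableOn (by simp)).differentiableAt (hnhds x ht)
    have h2 : DifferentiableAt ℝ (fun s : ℝ => H j (s, x)) t :=
      DifferentiableAt.comp (f := fun s : ℝ => (s, x)) t h1
        (differentiableAt_fun_id.prodMk (differentiableAt_const x))
    refine h2.congr_of_eventuallyEq ?_
    filter_upwards [Ico_mem_nhds ht.1 ht.2] with s hs
    exact hpart s hs j x

namespace TameField

variable {T M : ℝ} {φ : ℝ → Plane → Plane}

theorem lip_time (hφ : TameField T M φ) {s t : ℝ} (hs : s ∈ Ico 0 T) (ht : t ∈ Ico 0 T)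
    (x : Plane) : ‖φ s x - φ t x‖ ≤ M * |s - t| := by
  simpa using hφ.lip s hs t ht x x

theorem diff_time (hφ : TameField T M φ) {t : ℝ} (ht : t ∈ Ioo 0 T) (x : Plane) :
    DifferentiableAt ℝ (fun s => φ s x) t :=
  DifferentiableAt.comp (f := fun s : ℝ => (s, x)) t (hφ.diff t ht x)
    (differentiableAt_fun_id.prodMk (differentiableAt_const x))

theorem timeField (hφ : TameField T M φ) : TimeField T (Ioo 0 T) M φ :=
  ⟨hφ.smooth, fun _ hs _ ht x => hφ.lip_time hs ht x, hφ.lip_partial,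
    fun _ ht x => hφ.diff_time ht x, hφ.diff_partial⟩

theorem abs_streamIncr_le (hφ : TameField T M φ) {t : ℝ} (ht : t ∈ Ico 0 T) (c x : Plane) :
    |streamIncr (φ t) c x| ≤ 2 * M * ‖x - c‖ := Fluid.abs_streamIncr_le (hφ.bound t ht) c x

/-- The change of field at a fixed base point gives the first term, the change of base point the
second. -/
theorem abs_streamIncr_sub_le (hφ : TameField T M φ)
    (hdiv : ∀ t ∈ Ico 0 T, ∀ x, divergence (φ t) x = 0) {s t : ℝ} (hs : s ∈ Ico 0 T)
    (ht : t ∈ Ico 0 T) (c d x : Plane) :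
    |streamIncr (φ s) c x - streamIncr (φ t) d x| ≤
      2 * M * |s - t| * ‖x - c‖ + 2 * M * ‖c - d‖ := by
  have h1 := streamIncr_sub (hφ.smooth s hs).1.continuous (hφ.smooth t ht).1.continuous c x
  have h2 := streamIncr_sub_left (hφ.smooth t ht).1 (hdiv t ht) c d x
  rw [← sub_add_sub_cancel (streamIncr (φ s) c x) (streamIncr (φ t) c x), h1, h2]
  refine (abs_add_le _ _).trans (add_le_add ?_ ?_)
  · have := Fluid.abs_streamIncr_le (fun y => hφ.lip_time hs ht y) c x
    rwa [← mul_assoc] at this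
  · rw [norm_sub_rev c d]
    exact hφ.abs_streamIncr_le ht c d

/-- Differentiation under the segment integral, dominated by a Lipschitz constant in time: `h` is
differentiable at `t` itself but only Lipschitz around it. -/
theorem differentiableAt_streamIncr (hφ : TameField T M φ) (hM : 0 ≤ M) {h : ℝ → Plane} {L : ℝ}
    (hL : 0 ≤ L) (hh : ∀ s ∈ Ico 0 T, ∀ t ∈ Ico 0 T, ‖h s - h t‖ ≤ L * |s - t|) {t : ℝ}
    (ht : t ∈ Ioo 0 T) (hd : DifferentiableAt ℝ h t) (x : Plane) :
    DifferentiableAt ℝ (fun s => streamIncr (φ s) (h s) x) t := by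
  have hT : 0 < T := ht.1.trans ht.2
  have htI : t ∈ Ico 0 T := Ioo_subset_Ico_self ht
  have hnh : Ico 0 T ∈ 𝓝 t := Ico_mem_nhds ht.1 ht.2
  set F : ℝ → ℝ → ℝ := fun s r => wedge (φ s (h s + r • (x - h s))) (x - h s) with hF
  have hFc : ∀ s ∈ Ico 0 T, Continuous (F s) := fun s hs => by
    have := (hφ.smooth s hs).1.continuous
    fun_prop
  have hFd : ∀ r, DifferentiableAt ℝ (fun s => F s r) t := fun r => by
    have h1 : DifferentiableAt ℝ (fun s => h s + r • (x - h s)) t :=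
      hd.add ((hd.const_sub x).const_smul r)
    have h2 : DifferentiableAt ℝ (fun s => φ s (h s + r • (x - h s))) t :=
      DifferentiableAt.comp (f := fun s : ℝ => (s, h s + r • (x - h s))) t (hφ.diff t ht _)
        (differentiableAt_fun_id.prodMk h1)
    exact (wedge.differentiableAt.comp t h2).clm_apply (hd.const_sub x)
  set R : ℝ := ‖x - h t‖ + L * T with hR
  have hR0 : 0 ≤ R := by positivity
  have hRb : ∀ s ∈ Ico 0 T, ‖x - h s‖ ≤ R := fun s hs => by
    have h1 : ‖x - h s‖ ≤ ‖x - h t‖ + ‖h t - h s‖ := by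
      simpa using norm_add_le (x - h t) (h t - h s)
    refine h1.trans (add_le_add_right ((hh t htI s hs).trans ?_) _)
    gcongr
    rw [abs_le]
    constructor <;> linarith [hs.1, hs.2, ht.1, ht.2]
  -- The first term bounds the variation of `φ` along the moving segment, whose points have speed at
  -- most `L` and whose length is at most `R`; the second bounds the variation of the direction `x -
  -- h s`.
  set C : ℝ := 2 * (M * (1 + L)) * R + 2 * M * L with hC
  have hC0 : 0 ≤ C := by positivity
  have hlip : ∀ r ∈ uIoc (0 : ℝ) 1, LipschitzOnWith (Real.nnabs C) (fun s => F s r) (Ico 0 T) := by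
    intro r hr
    rw [uIoc_of_le zero_le_one] at hr
    refine LipschitzOnWith.of_dist_le_mul fun s hs s' hs' => ?_
    rw [Real.dist_eq, Real.dist_eq, Real.coe_nnabs, abs_of_nonneg hC0]
    set z := h s + r • (x - h s)
    set z' := h s' + r • (x - h s')
    have hz : ‖z - z'‖ ≤ L * |s - s'| := by
      have e : z - z' = (1 - r) • (h s - h s') := by module
      rw [e, norm_smul, Real.norm_eq_abs, abs_of_nonneg (by linarith [hr.2])]
      have := hh s hs s' hs'
      nlinarith [norm_nonneg (h s - h s'), hr.1]
    have e : F s r - F s' r =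
        wedge (φ s z - φ s' z') (x - h s) + wedge (φ s' z') (h s' - h s) := by
      simp only [hF, map_sub, _root_.sub_apply]
      ring
    rw [e]
    refine (abs_add_le _ _).trans ?_
    have h1 : ‖φ s z - φ s' z'‖ ≤ M * (1 + L) * |s - s'| :=
      (hφ.lip s hs s' hs' z z').trans (by nlinarith)
    have h2 : |wedge (φ s z - φ s' z') (x - h s)| ≤ 2 * (M * (1 + L) * |s - s'|) * R :=
      (norm_wedge_le _ _).trans (by gcongr; exact hRb s hs)
    have h3 : |wedge (φ s' z') (h s' - h s)| ≤ 2 * M * (L * |s - s'|) := by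
      refine (norm_wedge_le _ _).trans ?_
      gcongr
      · exact hφ.bound s' hs' z'
      · rw [norm_sub_rev]
        exact hh s hs s' hs'
    rw [hC]
    linarith
  exact (intervalIntegral.hasDerivAt_integral_of_dominated_loc_of_lip (μ := volume) (F := F)
    (F' := fun r => deriv (fun s => F s r) t) (a := 0) (b := 1) (bound := fun _ => C) hnh
    (by filter_upwards [hnh] with s hs using (hFc s hs).aestronglyMeasurable)
    ((hFc t htI).intervalIntegrable 0 1)
    (aestronglyMeasurable_of_hasDerivAt
      (by filter_upwards [hnh] with s hs using (hFc s hs).aestronglyMeasurable)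
      fun r => (hFd r).hasDerivAt)
    (ae_of_all _ hlip) intervalIntegrable_const
    (ae_of_all _ fun r _ => (hFd r).hasDerivAt)).2.differentiableAt

end TameField

/-! ### Rescaled cutoff functions -/

/-- A fixed smooth bump function which is `1` on `B(0, 1/2)` and vanishes outside `B(0, 3/4)`. -/
def unitBump : ContDiffBump (0 : Plane) := ⟨1 / 2, 3 / 4, by norm_num, by norm_num⟩

/-- The bump function rescaled to the ball of radius `η`. -/
def cut (η : ℝ) (y : Plane) : ℝ := unitBump (η⁻¹ • y)

theorem contDiff_cut (η : ℝ) : ContDiff ℝ ∞ (cut η) :=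
  unitBump.contDiff.comp (contDiff_const_smul _)

theorem cut_eq_one {η : ℝ} (hη : 0 < η) {y : Plane} (hy : ‖y‖ ≤ η / 2) : cut η y = 1 := by
  refine unitBump.one_of_mem_closedBall ?_
  rw [mem_closedBall_zero_iff, norm_smul, norm_inv, Real.norm_eq_abs, abs_of_pos hη,
    inv_mul_le_iff₀ hη]
  simpa [unitBump, div_eq_mul_inv] using hy

theorem cut_eq_zero {η : ℝ} (hη : 0 < η) {y : Plane} (hy : 3 / 4 * η ≤ ‖y‖) : cut η y = 0 := by
  refine unitBump.zero_of_le_dist ?_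
  rw [dist_zero_right, norm_smul, norm_inv, Real.norm_eq_abs, abs_of_pos hη, le_inv_mul_iff₀ hη,
    mul_comm]
  exact hy

/-- `K` is a differentiable kernel supported in the ball of radius `η`, bounded by `B` and
Lipschitz with constant `Λ`. -/
structure IsKernel {F : Type*} [NormedAddCommGroup F] [NormedSpace ℝ F] (η B Λ : ℝ)
    (K : Plane → F) : Prop where
  bound : ∀ y, ‖K y‖ ≤ B
  lip : ∀ y z, ‖K y - K z‖ ≤ Λ * ‖y - z‖
  vanish : ∀ y, η ≤ ‖y‖ → K y = 0
  diff : Differentiable ℝ K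

theorem IsKernel.const_smul {F : Type*} [NormedAddCommGroup F] [NormedSpace ℝ F] {η B Λ : ℝ}
    {K : Plane → F} (hK : IsKernel η B Λ K) {c : ℝ} (hc : 0 ≤ c) :
    IsKernel η (c * B) (c * Λ) fun y => c • K y where
  bound y := by
    rw [norm_smul, Real.norm_eq_abs, abs_of_nonneg hc]
    exact mul_le_mul_of_nonneg_left (hK.bound y) hc
  lip y z := by
    rw [← smul_sub, norm_smul, Real.norm_eq_abs, abs_of_nonneg hc, mul_assoc]
    exact mul_le_mul_of_nonneg_left (hK.lip y z) hc
  vanish y hy := by rw [hK.vanish y hy, smul_zero]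
  diff := hK.diff.const_smul c

/-- Rescaling keeps the supremum and multiplies the Lipschitz constant by `η⁻¹`. -/
theorem exists_isKernel_scaled {F : Type*} [NormedAddCommGroup F] [NormedSpace ℝ F]
    {b : Plane → F} (hb : ContDiff ℝ ∞ b) (hs : tsupport b ⊆ Metric.closedBall 0 (3 / 4)) :
    ∃ C, ∀ η > 0, IsKernel η C (C / η) fun y => b (η⁻¹ • y) := by
  have hc : HasCompactSupport b :=
    (isCompact_closedBall (0 : Plane) (3 / 4)).of_isClosed_subset (isClosed_tsupport b) hs
  obtain ⟨A, hA⟩ := hc.exists_bound_of_continuous hb.continuous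
  obtain ⟨B, hB⟩ := (hc.fderiv ℝ).exists_bound_of_continuous (hb.continuous_fderiv (by simp))
  refine ⟨max A B, fun η hη => ⟨fun y => (hA _).trans (le_max_left _ _), fun y z => ?_,
    fun y hy => ?_, (hb.differentiable (by simp)).comp
      (differentiable_id.fun_const_smul _)⟩⟩
  · have h1 := convex_univ.norm_image_sub_le_of_norm_fderiv_le (f := b) (C := max A B)
      (fun x _ => hb.differentiable (by simp) x) (fun x _ => (hB x).trans (le_max_right _ _))
      (mem_univ (η⁻¹ • z)) (mem_univ (η⁻¹ • y))
    rwa [← smul_sub, norm_smul, norm_inv, Real.norm_eq_abs, abs_of_pos hη, ← mul_assoc,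
      ← div_eq_mul_inv] at h1
  · refine image_eq_zero_of_notMem_tsupport fun h => ?_
    have h1 := hs h
    rw [mem_closedBall_zero_iff, norm_smul, norm_inv, Real.norm_eq_abs, abs_of_pos hη,
      inv_mul_le_iff₀ hη] at h1
    linarith

/-- The kernel `∇^⊥` of the cutoff function. -/
def cutCurl (η : ℝ) (y : Plane) : Plane := rotGrad (cut η) y

theorem fderiv_cut (η : ℝ) (y : Plane) :
    fderiv ℝ (cut η) y = η⁻¹ • fderiv ℝ unitBump (η⁻¹ • y) :=
  fderiv_comp_smul (f := unitBump) η⁻¹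

theorem cutCurl_eq (η : ℝ) (y : Plane) : cutCurl η y = η⁻¹ • rotGrad unitBump (η⁻¹ • y) := by
  rw [cutCurl, rotGrad, fderiv_cut, map_smul]
  rfl

theorem contDiff_cutCurl (η : ℝ) : ContDiff ℝ ∞ (cutCurl η) := (contDiff_cut η).rotGrad

theorem fderiv_cutCurl (η : ℝ) (y : Plane) :
    fderiv ℝ (cutCurl η) y = η⁻¹ • η⁻¹ • fderiv ℝ (rotGrad unitBump) (η⁻¹ • y) := by
  have h : cutCurl η = η⁻¹ • fun y => rotGrad unitBump (η⁻¹ • y) := funext (cutCurl_eq η)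
  have hd : Differentiable ℝ fun y : Plane => rotGrad unitBump (η⁻¹ • y) :=
    (unitBump.contDiff.rotGrad.differentiable (by simp)).comp
      (differentiable_id.fun_const_smul _)
  rw [h, fderiv_const_smul (hd y)]
  congr 1
  exact fderiv_comp_smul (f := rotGrad unitBump) η⁻¹

/-- Each derivative of the cutoff costs a factor `η⁻¹`. A single `C`, the sum of the absolute values
of the constants for the unit profiles, serves all these kernels. -/
theorem exists_isKernel_cut : ∃ C, 0 ≤ C ∧ ∀ η > 0,
    IsKernel η C (C / η) (cut η) ∧
    IsKernel η (C / η) (C / η ^ 2) (cutCurl η) ∧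
    (∀ j, IsKernel η (C / η) (C / η ^ 2) fun y => fderiv ℝ (cut η) y (basisVec j)) ∧
    ∀ j, IsKernel η (C / η ^ 2) (C / η ^ 3) fun y => fderiv ℝ (cutCurl η) y (basisVec j) := by
  have hts : tsupport unitBump ⊆ Metric.closedBall 0 (3 / 4) := unitBump.tsupport_eq.subset
  have hb : ContDiff ℝ ∞ unitBump := unitBump.contDiff
  have hr : ContDiff ℝ ∞ (rotGrad unitBump) := hb.rotGrad
  have hbr : tsupport (rotGrad unitBump) ⊆ Metric.closedBall 0 (3 / 4) := by
    refine (closure_mono fun x hx => ?_).trans ((tsupport_fderiv_subset ℝ).trans hts)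
    contrapose! hx
    simp only [Function.mem_support, not_not] at hx
    simp [rotGrad, hx]
  have key : ∀ {F : Type} [NormedAddCommGroup F] [NormedSpace ℝ F] {b : Plane → F},
      ContDiff ℝ ∞ b → tsupport b ⊆ Metric.closedBall 0 (3 / 4) → ∀ j,
      ∃ C, ∀ η > 0, IsKernel η C (C / η) fun y => fderiv ℝ b (η⁻¹ • y) (basisVec j) := by
    intro F _ _ b hb hs j
    refine exists_isKernel_scaled (b := fun y => fderiv ℝ b y (basisVec j))
      ((hb.fderiv_right (m := ∞) (by simp)).clm_apply contDiff_const) ?_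
    refine (closure_mono fun x hx => ?_).trans ((tsupport_fderiv_subset ℝ).trans hs)
    contrapose! hx
    simp only [Function.mem_support, not_not] at hx
    simp [hx]
  obtain ⟨C₁, h1⟩ := exists_isKernel_scaled hb hts
  obtain ⟨C₂, h2⟩ := exists_isKernel_scaled hr hbr
  choose C₃ h3 using key hb hts
  choose C₄ h4 using key hr hbr
  set C : ℝ := |C₁| + |C₂| + ∑ j, |C₃ j| + ∑ j, |C₄ j| with hC
  have e3 := fun j => Finset.single_le_sum (fun j _ => abs_nonneg (C₃ j)) (Finset.mem_univ j)
  have e4 := fun j => Finset.single_le_sum (fun j _ => abs_nonneg (C₄ j)) (Finset.mem_univ j)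
  have s3 := Finset.sum_nonneg fun j (_ : j ∈ Finset.univ) => abs_nonneg (C₃ j)
  have s4 := Finset.sum_nonneg fun j (_ : j ∈ Finset.univ) => abs_nonneg (C₄ j)
  have p1 := abs_nonneg C₁
  have p2 := abs_nonneg C₂
  have l1 : C₁ ≤ C := by linarith [le_abs_self C₁]
  have l2 : C₂ ≤ C := by linarith [le_abs_self C₂]
  have l3 : ∀ j, C₃ j ≤ C := fun j => by linarith [le_abs_self (C₃ j), e3 j]
  have l4 : ∀ j, C₄ j ≤ C := fun j => by linarith [le_abs_self (C₄ j), e4 j]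
  have mono : ∀ {F : Type} [NormedAddCommGroup F] [NormedSpace ℝ F] {K : Plane → F} {η C' : ℝ}
      (_ : 0 < η) (_ : C' ≤ C), IsKernel η C' (C' / η) K → IsKernel η C (C / η) K := by
    intro F _ _ K η C' hη hle hK
    refine ⟨fun y => (hK.bound y).trans hle, fun y z => (hK.lip y z).trans ?_, hK.vanish, hK.diff⟩
    gcongr
  refine ⟨C, by positivity, fun η hη => ⟨mono hη l1 (h1 η hη), ?_, fun j => ?_, fun j => ?_⟩⟩
  · have := (mono hη l2 (h2 η hη)).const_smul (inv_nonneg.2 hη.le)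
    convert this using 1
    · field_simp
    · field_simp
    · exact funext (cutCurl_eq η)
  · have := (mono hη (l3 j) (h3 j η hη)).const_smul (inv_nonneg.2 hη.le)
    convert this using 1
    · field_simp
    · field_simp
    · funext y
      rw [fderiv_cut]
      rfl
  · have := ((mono hη (l4 j) (h4 j η hη)).const_smul (inv_nonneg.2 hη.le)).const_smul
      (inv_nonneg.2 hη.le)
    convert this using 1
    · field_simp
    · field_simp
    · funext y
      rw [fderiv_cutCurl]
      rfl

/-! ### The correction near one moving point -/

/-- The field `∇^⊥ (χ_η(x - c) (ψ(x) - ψ(c)))`, where `ψ` is a stream function of `f`. -/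
def correction (η : ℝ) (f : Plane → Plane) (c x : Plane) : Plane :=
  rotGrad (fun y => cut η (y - c) * streamIncr f c y) x

section Correction

variable {η : ℝ} {f : Plane → Plane} {c : Plane}

theorem contDiff_cut_mul_streamIncr (hf : ContDiff ℝ ∞ f) (hdiv : ∀ x, divergence f x = 0) :
    ContDiff ℝ ∞ fun y => cut η (y - c) * streamIncr f c y :=
  ((contDiff_cut η).comp (contDiff_id.sub contDiff_const)).mul (contDiff_streamIncr hf hdiv c)

/-- Product rule with `∇^⊥ψ = f`. In the second term the size `η⁻¹` of `cutCurl` is offset by the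
vanishing of the stream increment at `c`. -/
theorem correction_eq (hf : ContDiff ℝ ∞ f) (hdiv : ∀ x, divergence f x = 0) (x : Plane) :
    correction η f c x = cut η (x - c) • f x + streamIncr f c x • cutCurl η (x - c) := by
  have h1 : HasFDerivAt (fun y => cut η (y - c)) (fderiv ℝ (cut η) (x - c)) x := by
    have := ((contDiff_cut η).differentiable (by simp) (x - c)).hasFDerivAt.comp x
      ((hasFDerivAt_id x).sub_const c)
    simpa using! this
  have h2 := h1.fun_mul (hasFDerivAt_streamIncr hf hdiv c x)
  rw [correction, rotGrad, h2.fderiv, map_add, map_smul, map_smul, rot_wedge]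
  rfl

theorem partialDeriv_correction (hf : ContDiff ℝ ∞ f) (hdiv : ∀ x, divergence f x = 0)
    (j : Fin 2) (x : Plane) :
    partialDeriv j (correction η f c) x =
      (cut η (x - c) • partialDeriv j f x + fderiv ℝ (cut η) (x - c) (basisVec j) • f x) +
      (streamIncr f c x • fderiv ℝ (cutCurl η) (x - c) (basisVec j) +
        wedge (f x) (basisVec j) • cutCurl η (x - c)) := by
  have h1 : HasFDerivAt (fun y => cut η (y - c)) (fderiv ℝ (cut η) (x - c)) x := by
    have := ((contDiff_cut η).differentiable (by simp) (x - c)).hasFDerivAt.comp x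
      ((hasFDerivAt_id x).sub_const c)
    simpa using! this
  have h2 : HasFDerivAt (fun y => cutCurl η (y - c)) (fderiv ℝ (cutCurl η) (x - c)) x := by
    have := ((contDiff_cutCurl η).differentiable (by simp) (x - c)).hasFDerivAt.comp x
      ((hasFDerivAt_id x).sub_const c)
    simpa using! this
  have h3 := (hf.differentiable (by simp) x).hasFDerivAt
  have h4 := (h1.fun_smul h3).fun_add ((hasFDerivAt_streamIncr hf hdiv c x).fun_smul h2)
  rw [show correction η f c = _ from funext fun x => correction_eq hf hdiv x, partialDeriv]
  rw [h4.fderiv]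
  simp [partialDeriv]

theorem tsupport_correction_subset (hη : 0 < η) :
    tsupport (correction η f c) ⊆ Metric.closedBall c (3 / 4 * η) := by
  have h0 : tsupport (fun y => cut η (y - c) * streamIncr f c y) ⊆
      Metric.closedBall c (3 / 4 * η) := by
    refine closure_minimal (fun x hx => ?_) Metric.isClosed_closedBall
    contrapose! hx
    rw [mem_closedBall_iff_norm, not_le] at hx
    simp [cut_eq_zero hη hx.le]
  refine (closure_mono fun x hx => ?_).trans ((tsupport_fderiv_subset ℝ).trans h0)
  contrapose! hx
  simp only [Function.mem_support, not_not] at hx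
  simp [correction, rotGrad, hx]

theorem smoothCompact_correction (hη : 0 < η) (hf : ContDiff ℝ ∞ f)
    (hdiv : ∀ x, divergence f x = 0) : SmoothCompact (correction η f c) :=
  ⟨(contDiff_cut_mul_streamIncr hf hdiv).rotGrad,
    (isCompact_closedBall c (3 / 4 * η)).of_isClosed_subset (isClosed_tsupport _)
      (tsupport_correction_subset hη)⟩

theorem divergence_correction (hf : ContDiff ℝ ∞ f) (hdiv : ∀ x, divergence f x = 0) (x : Plane) :
    divergence (correction η f c) x = 0 :=
  divergence_rotGrad (contDiff_cut_mul_streamIncr hf hdiv) x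

theorem correction_eq_zero (hη : 0 < η) {x : Plane} (hx : 3 / 4 * η < ‖x - c‖) :
    correction η f c x = 0 :=
  image_eq_zero_of_notMem_tsupport fun h => by
    have := tsupport_correction_subset hη h
    rw [mem_closedBall_iff_norm] at this
    linarith

theorem partialDeriv_correction_eq_zero (hη : 0 < η) (j : Fin 2) {x : Plane}
    (hx : 3 / 4 * η < ‖x - c‖) : partialDeriv j (correction η f c) x = 0 := by
  have : fderiv ℝ (correction η f c) x = 0 := image_eq_zero_of_notMem_tsupport fun h => by
    have := tsupport_correction_subset hη (tsupport_fderiv_subset ℝ h)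
    rw [mem_closedBall_iff_norm] at this
    linarith
  rw [partialDeriv, this, _root_.zero_apply]

theorem correction_eq_self (hη : 0 < η) (hf : ContDiff ℝ ∞ f) (hdiv : ∀ x, divergence f x = 0)
    {x : Plane} (hx : x ∈ Metric.ball c (η / 2)) : correction η f c x = f x := by
  have h : (fun y => cut η (y - c) * streamIncr f c y) =ᶠ[𝓝 x] streamIncr f c := by
    filter_upwards [Metric.isOpen_ball.mem_nhds hx] with y hy
    rw [cut_eq_one hη (mem_ball_iff_norm.1 hy).le, one_mul]
  rw [correction, rotGrad, h.fderiv_eq, (hasFDerivAt_streamIncr hf hdiv c x).fderiv, rot_wedge]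

/-- The stream function normalised at the centre vanishes on the whole disc, not merely its
gradient. Thus a centre near or outside the boundary of Ω does no harm. -/
theorem correction_eq_zero_of_vanishing (hη : 0 < η) (hf : ∀ y ∈ Metric.ball c η, f y = 0) :
    correction η f c = fun _ => 0 := by
  have h : (fun y => cut η (y - c) * streamIncr f c y) = fun _ => 0 := by
    funext y
    by_cases hy : y ∈ Metric.ball c η
    · rw [streamIncr_eq_zero hf hy, mul_zero]
    · rw [mem_ball_iff_norm, not_lt] at hy
      rw [cut_eq_zero hη (by linarith), zero_mul]
  funext x
  simp [correction, rotGrad, h]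

theorem isTest_correction {Ω : Set Plane} (hΩ : IsOpen Ω) (hη : 0 < η) (hf : IsTest Ω f)
    (hdiv : ∀ x, divergence f x = 0)
    (hdist : ∀ x ∈ tsupport f, ∀ y ∈ frontier Ω, 2 * η ≤ dist x y) :
    IsTest Ω (correction η f c) := by
  refine ⟨smoothCompact_correction hη hf.1.1 hdiv, ?_⟩
  by_cases h : ∀ y ∈ Metric.ball c η, f y = 0
  · rw [correction_eq_zero_of_vanishing hη h]
    simp [tsupport]
  · push Not at h
    obtain ⟨y, hy, hfy⟩ := h
    have hys : y ∈ tsupport f := subset_tsupport f hfy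
    have hsub : Metric.ball c η ⊆ Ω := by
      -- The disc has diameter `2η` and contains a point of the support of `f`, so it misses the
      -- frontier; being connected and meeting Ω, it lies in Ω.
      have hfr : ∀ z ∈ Metric.ball c η, z ∉ frontier Ω := fun z hz hzf => by
        have h1 := hdist y hys z hzf
        have h2 := dist_triangle_right y z c
        rw [Metric.mem_ball] at hy hz
        linarith
      refine (convex_ball c η).isPreconnected.subset_of_closure_inter_subset hΩ
        ⟨y, hy, hf.2 hys⟩ fun z hz => ?_
      by_contra hzΩ
      exact hfr z hz.2 ⟨hz.1, by rwa [hΩ.interior_eq]⟩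
    refine (tsupport_correction_subset hη).trans (Subset.trans ?_ hsub)
    exact Metric.closedBall_subset_ball (by linarith)

end Correction

/-! ### Time regularity of the correction -/

section Kernels

variable {E : Type*} [NormedAddCommGroup E] [NormedSpace ℝ E] {η B Λ L M δ : ℝ} {w w' : Plane}

theorem norm_smul_sub_smul_le (a a' : ℝ) (b b' : E) :
    ‖a • b - a' • b'‖ ≤ |a - a'| * ‖b‖ + |a'| * ‖b - b'‖ := by
  have e : a • b - a' • b' = (a - a') • b + a' • (b - b') := by module
  rw [e]
  refine (norm_add_le _ _).trans ?_
  rw [norm_smul, norm_smul, Real.norm_eq_abs, Real.norm_eq_abs]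

theorem IsKernel.bound_nonneg {K : Plane → E} (hK : IsKernel η B Λ K) : 0 ≤ B :=
  (norm_nonneg _).trans (hK.bound 0)

theorem IsKernel.lip_nonneg {K : Plane → E} (hK : IsKernel η B Λ K) : 0 ≤ Λ := by
  have := (norm_nonneg _).trans (hK.lip (basisVec 0) 0)
  rwa [sub_zero, norm_basisVec, mul_one] at this

theorem IsKernel.lip_of_le {K : Plane → E} (hK : IsKernel η B Λ K) (hw : ‖w - w'‖ ≤ L * δ) :
    ‖K w - K w'‖ ≤ Λ * (L * δ) :=
  (hK.lip w w').trans (mul_le_mul_of_nonneg_left hw hK.lip_nonneg)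

theorem IsKernel.norm_smul_sub_smul_le {K : Plane → ℝ} (hK : IsKernel η B Λ K)
    (hw : ‖w - w'‖ ≤ L * δ) {f f' : E} (hf : ‖f‖ ≤ M) (hff : ‖f - f'‖ ≤ M * δ) :
    ‖K w • f - K w' • f'‖ ≤ (Λ * L + B) * M * δ := by
  refine (Fluid.norm_smul_sub_smul_le _ _ _ _).trans ?_
  have h1 := mul_le_mul (hK.lip_of_le hw) hf (norm_nonneg _)
    ((norm_nonneg _).trans (hK.lip_of_le hw))
  have h2 := mul_le_mul (hK.bound w') hff (norm_nonneg _) hK.bound_nonneg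
  rw [Real.norm_eq_abs] at h1 h2
  linarith

theorem IsKernel.norm_smul_sub_smul_le' {K : Plane → E} (hK : IsKernel η B Λ K)
    (hw : ‖w - w'‖ ≤ L * δ) {g g' : ℝ} (hg : |g'| ≤ M) (hgg : |g - g'| ≤ M * δ) :
    ‖g • K w - g' • K w'‖ ≤ (Λ * L + B) * M * δ := by
  refine (Fluid.norm_smul_sub_smul_le _ _ _ _).trans ?_
  have h1 := mul_le_mul hgg (hK.bound w) (norm_nonneg _) ((abs_nonneg _).trans hgg)
  have h2 := mul_le_mul hg (hK.lip_of_le hw) (norm_nonneg _) ((abs_nonneg _).trans hg)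
  linarith

/-- A coefficient vanishing linearly at the centre gains a factor `η` on the support of the kernel.
-/
theorem IsKernel.norm_smul_le_of_vanishing {K : Plane → E} (hK : IsKernel η B Λ K) (hM : 0 ≤ M)
    (hη : 0 < η) {p : ℝ} (hp : |p| ≤ M * ‖w‖) : ‖p • K w‖ ≤ M * η * B := by
  have hB := hK.bound_nonneg
  by_cases h : η ≤ ‖w‖
  · rw [hK.vanish w h, smul_zero, norm_zero]
    positivity
  · rw [norm_smul, Real.norm_eq_abs]
    refine mul_le_mul (hp.trans ?_) (hK.bound w) (norm_nonneg _) (by positivity)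
    exact mul_le_mul_of_nonneg_left (not_le.1 h).le hM

/-- The same gain for time increments. The difference of products is split so that the undifferenced
coefficient is always evaluated at a point within distance `η` of the centre: `p` if `w` lies in the
disc, `p'` otherwise. -/
theorem IsKernel.norm_smul_sub_smul_le_of_vanishing {K : Plane → E} (hK : IsKernel η B Λ K)
    (hM : 0 ≤ M) (hη : 0 < η) (hL : 0 ≤ L) (hδ : 0 ≤ δ) (hw : ‖w - w'‖ ≤ L * δ) {p p' : ℝ}
    (hp : |p| ≤ M * ‖w‖) (hp' : |p'| ≤ M * ‖w'‖) (hpp : |p - p'| ≤ M * δ * (‖w‖ + L)) :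
    ‖p • K w - p' • K w'‖ ≤ (Λ * L * η + B * (η + L)) * M * δ := by
  have hB := hK.bound_nonneg
  have hΛ := hK.lip_nonneg
  have hl := hK.lip_of_le hw
  by_cases h : η ≤ ‖w‖
  · by_cases h' : η ≤ ‖w'‖
    · rw [hK.vanish w h, hK.vanish w' h', smul_zero, smul_zero, sub_zero, norm_zero]
      positivity
    · have e : p • K w - p' • K w' = p' • (K w - K w') := by rw [hK.vanish w h]; simp
      rw [e, norm_smul, Real.norm_eq_abs]
      have h1 : |p'| ≤ M * η := hp'.trans (mul_le_mul_of_nonneg_left (not_le.1 h').le hM)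
      have h2 := mul_le_mul h1 hl (norm_nonneg _) (by positivity)
      have h3 : 0 ≤ B * (η + L) * M * δ := by positivity
      linarith
  · have hwη := (not_le.1 h).le
    have e : p • K w - p' • K w' = p • (K w - K w') + (p - p') • K w' := by module
    rw [e]
    refine (norm_add_le _ _).trans ?_
    rw [norm_smul, norm_smul, Real.norm_eq_abs, Real.norm_eq_abs]
    have h1 : |p| ≤ M * η := hp.trans (mul_le_mul_of_nonneg_left hwη hM)
    have h2 := mul_le_mul h1 hl (norm_nonneg _) (by positivity)
    have h3 : |p - p'| ≤ M * δ * (η + L) := hpp.trans (by gcongr)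
    have h4 := mul_le_mul h3 (hK.bound w') (norm_nonneg _) (by positivity)
    linarith

end Kernels

/-- The correction of a time-dependent field along a moving point. -/
def movingCorrection (φ : ℝ → Plane → Plane) (h : ℝ → Plane) (η t : ℝ) : Plane → Plane :=
  correction η (φ t) (h t)

/-- The last three bounds have the size `C / η` matching concentration on discs of radius `η`. The
constant `L'`, which also controls time increments of the space derivatives, may depend on `η` in
any way: it only serves to place the field in `W^{1,∞}` for fixed `η`. -/
theorem exists_movingCorrection_bounds {T M L η₁ : ℝ} {φ : ℝ → Plane → Plane} {h : ℝ → Plane}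
    {S : Set ℝ} (hφ : TameField T M φ) (hM : 0 ≤ M)
    (hdiv : ∀ t ∈ Ico 0 T, ∀ x, divergence (φ t) x = 0) (hL : 0 ≤ L)
    (hh : ∀ s ∈ Ico 0 T, ∀ t ∈ Ico 0 T, ‖h s - h t‖ ≤ L * |s - t|) (hS : S ⊆ Ioo 0 T)
    (hd : ∀ t ∈ S, DifferentiableAt ℝ h t) :
    ∃ C, ∀ η ∈ Ioc 0 η₁,
      (∃ L', TimeField T S L' (movingCorrection φ h η)) ∧
      (∀ t ∈ Ico 0 T, ∀ x, ‖movingCorrection φ h η t x‖ ≤ C / η) ∧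
      (∀ t ∈ Ico 0 T, ∀ j x, ‖partialDeriv j (movingCorrection φ h η t) x‖ ≤ C / η) ∧
      ∀ s ∈ Ico 0 T, ∀ t ∈ Ico 0 T, ∀ x,
        ‖movingCorrection φ h η s x - movingCorrection φ h η t x‖ ≤ C / η * |s - t| := by
  obtain ⟨C, hC, hker⟩ := exists_isKernel_cut
  -- The bracket majorises `3 * L + 2 * η`, `2 * η` and `η + 3`, which come from the time increment,
  -- the amplitude and the space derivative.
  refine ⟨2 * M * C * (3 * L + 3 * η₁ + 5), fun η hη => ?_⟩
  obtain ⟨k0, k1, k0', k1'⟩ := hker η hη.1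
  have hη0 := hη.1
  have hη1 := hη.2
  -- The factor `2` of `norm_wedge_le` enters the stream function bounds; using `2 * M` for all
  -- other quantities too keeps one constant.
  have hM2 : 0 ≤ 2 * M := by positivity
  have hp : ∀ t ∈ Ico 0 T, ∀ x, |streamIncr (φ t) (h t) x| ≤ 2 * M * ‖x - h t‖ := fun t ht x =>
    hφ.abs_streamIncr_le ht _ _
  have hpp : ∀ s ∈ Ico 0 T, ∀ t ∈ Ico 0 T, ∀ x,
      |streamIncr (φ s) (h s) x - streamIncr (φ t) (h t) x| ≤
        2 * M * |s - t| * (‖x - h s‖ + L) := fun s hs t ht x => by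
    refine (hφ.abs_streamIncr_sub_le hdiv hs ht _ _ _).trans ?_
    have := mul_le_mul_of_nonneg_left (hh s hs t ht) hM2
    linarith
  have hw : ∀ s ∈ Ico 0 T, ∀ t ∈ Ico 0 T, ∀ x, ‖(x - h s) - (x - h t)‖ ≤ L * |s - t| :=
    fun s hs t ht x => by
      rw [sub_sub_sub_cancel_left, norm_sub_rev]
      exact hh s hs t ht
  have hb : ∀ t ∈ Ico 0 T, ∀ x, ‖φ t x‖ ≤ 2 * M := fun t ht x => by
    linarith [hφ.bound t ht x]
  have hbl : ∀ s ∈ Ico 0 T, ∀ t ∈ Ico 0 T, ∀ x, ‖φ s x - φ t x‖ ≤ 2 * M * |s - t| :=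
    fun s hs t ht x => by
      have := hφ.lip_time hs ht x
      nlinarith [mul_nonneg hM (abs_nonneg (s - t))]
  have hpb : ∀ t ∈ Ico 0 T, ∀ j x, ‖partialDeriv j (φ t) x‖ ≤ 2 * M := fun t ht j x => by
    linarith [hφ.bound_partial t ht j x]
  have hpbl : ∀ s ∈ Ico 0 T, ∀ t ∈ Ico 0 T, ∀ j x,
      ‖partialDeriv j (φ s) x - partialDeriv j (φ t) x‖ ≤ 2 * M * |s - t| :=
    fun s hs t ht j x => by
      have := hφ.lip_partial s hs t ht j x
      nlinarith [mul_nonneg hM (abs_nonneg (s - t))]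
  have hg : ∀ t ∈ Ico 0 T, ∀ j x, |wedge (φ t x) (basisVec j)| ≤ 2 * M := fun t ht j x => by
    have := norm_wedge_le (φ t x) (basisVec j)
    rw [norm_basisVec, mul_one] at this
    linarith [hφ.bound t ht x]
  have hgl : ∀ s ∈ Ico 0 T, ∀ t ∈ Ico 0 T, ∀ j x,
      |wedge (φ s x) (basisVec j) - wedge (φ t x) (basisVec j)| ≤ 2 * M * |s - t| :=
    fun s hs t ht j x => by
      have := norm_wedge_le (φ s x - φ t x) (basisVec j)
      rw [norm_basisVec, mul_one, map_sub, _root_.sub_apply] at this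
      linarith [hφ.lip_time hs ht x]
  have eD : ∀ t ∈ Ico 0 T, ∀ x, movingCorrection φ h η t x = _ := fun t ht x =>
    correction_eq (η := η) (c := h t) (hφ.smooth t ht).1 (hdiv t ht) x
  have eP : ∀ t ∈ Ico 0 T, ∀ j x, partialDeriv j (movingCorrection φ h η t) x = _ :=
    fun t ht j x =>
      partialDeriv_correction (η := η) (c := h t) (hφ.smooth t ht).1 (hdiv t ht) j x
  have hlip : ∀ s ∈ Ico 0 T, ∀ t ∈ Ico 0 T, ∀ x,
      ‖movingCorrection φ h η s x - movingCorrection φ h η t x‖ ≤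
        2 * M * C * (3 * L + 3 * η₁ + 5) / η * |s - t| := fun s hs t ht x => by
    rw [eD s hs, eD t ht, add_sub_add_comm]
    refine (norm_add_le _ _).trans ?_
    have h1 := k0.norm_smul_sub_smul_le (hw s hs t ht x) (hb s hs x) (hbl s hs t ht x)
    have h2 := k1.norm_smul_sub_smul_le_of_vanishing hM2 hη0 hL (abs_nonneg _) (hw s hs t ht x)
      (hp s hs x) (hp t ht x) (hpp s hs t ht x)
    refine (add_le_add h1 h2).trans ?_
    rw [← add_mul, ← add_mul]
    refine mul_le_mul_of_nonneg_right ?_ (abs_nonneg _)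
    have e : (C / η * L + C + (C / η ^ 2 * L * η + C / η * (η + L))) * (2 * M) =
        2 * M * C * (3 * L + 2 * η) / η := by
      field_simp
      ring
    rw [e]
    exact div_le_div_of_nonneg_right
      (mul_le_mul_of_nonneg_left (by linarith) (by positivity)) hη0.le
  -- The second entry collects the increments of the four terms of `partialDeriv_correction`, in
  -- order.
  refine ⟨⟨max (2 * M * C * (3 * L + 3 * η₁ + 5) / η)
    ((C / η * L + C) * (2 * M) + (C / η ^ 2 * L + C / η) * (2 * M) +
      ((C / η ^ 3 * L * η + C / η ^ 2 * (η + L)) * (2 * M) +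
        (C / η ^ 2 * L + C / η) * (2 * M))), fun t ht => ?_, fun s hs t ht x => ?_,
    fun s hs t ht j x => ?_, fun t ht x => ?_, fun t ht j x => ?_⟩, fun t ht x => ?_,
    fun t ht j x => ?_, hlip⟩
  · exact smoothCompact_correction hη0 (hφ.smooth t ht).1 (hdiv t ht)
  · refine (hlip s hs t ht x).trans ?_
    gcongr
    exact le_max_left _ _
  · rw [eP s hs, eP t ht, add_sub_add_comm, add_sub_add_comm, add_sub_add_comm]
    have h1 := k0.norm_smul_sub_smul_le (hw s hs t ht x) (hpb s hs j x) (hpbl s hs t ht j x)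
    have h2 := (k0' j).norm_smul_sub_smul_le (hw s hs t ht x) (hb s hs x) (hbl s hs t ht x)
    have h3 := (k1' j).norm_smul_sub_smul_le_of_vanishing hM2 hη0 hL (abs_nonneg _)
      (hw s hs t ht x) (hp s hs x) (hp t ht x) (hpp s hs t ht x)
    have h4 := k1.norm_smul_sub_smul_le' (hw s hs t ht x) (hg t ht j x) (hgl s hs t ht j x)
    refine (norm_add_le_of_le (norm_add_le_of_le h1 h2) (norm_add_le_of_le h3 h4)).trans ?_
    refine le_of_eq_of_le ?_ (mul_le_mul_of_nonneg_right (le_max_right _ _) (abs_nonneg _))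
    ring
  · have hm : Ico 0 T ∈ 𝓝 t := Ico_mem_nhds (hS ht).1 (hS ht).2
    have hx : DifferentiableAt ℝ (fun s => x - h s) t := (hd t ht).const_sub x
    have d0 : DifferentiableAt ℝ (fun s => cut η (x - h s)) t := (k0.diff _).comp t hx
    have d1 : DifferentiableAt ℝ (fun s => cutCurl η (x - h s)) t := (k1.diff _).comp t hx
    have d2 := hφ.differentiableAt_streamIncr hM hL hh (hS ht) (hd t ht) x
    refine ((d0.fun_smul (hφ.diff_time (hS ht) x)).fun_add (d2.fun_smul d1)).congr_of_eventuallyEq ?_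
    filter_upwards [hm] with s hs using eD s hs x
  · have hm : Ico 0 T ∈ 𝓝 t := Ico_mem_nhds (hS ht).1 (hS ht).2
    have hx : DifferentiableAt ℝ (fun s => x - h s) t := (hd t ht).const_sub x
    have d0 : DifferentiableAt ℝ (fun s => cut η (x - h s)) t := (k0.diff _).comp t hx
    have d1 : DifferentiableAt ℝ (fun s => cutCurl η (x - h s)) t := (k1.diff _).comp t hx
    have d0' : DifferentiableAt ℝ (fun s => fderiv ℝ (cut η) (x - h s) (basisVec j)) t :=
      DifferentiableAt.comp (f := fun s => x - h s) t ((k0' j).diff _) hx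
    have d1' : DifferentiableAt ℝ (fun s => fderiv ℝ (cutCurl η) (x - h s) (basisVec j)) t :=
      DifferentiableAt.comp (f := fun s => x - h s) t ((k1' j).diff _) hx
    have d2 := hφ.differentiableAt_streamIncr hM hL hh (hS ht) (hd t ht) x
    have d3 := hφ.diff_time (hS ht) x
    have d4 : DifferentiableAt ℝ (fun s => wedge (φ s x) (basisVec j)) t :=
      (wedge.differentiableAt.comp t d3).clm_apply (differentiableAt_const _)
    refine (((d0.fun_smul (hφ.diff_partial t (hS ht) j x)).fun_add (d0'.fun_smul d3)).fun_add
      ((d2.fun_smul d1').fun_add (d4.fun_smul d1))).congr_of_eventuallyEq ?_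
    filter_upwards [hm] with s hs using eP s hs j x
  · rw [eD t ht]
    have h1 : ‖cut η (x - h t) • φ t x‖ ≤ C * (2 * M) := by
      rw [norm_smul]
      exact mul_le_mul (k0.bound _) (hb t ht x) (norm_nonneg _) hC
    have h2 := k1.norm_smul_le_of_vanishing hM2 hη0 (hp t ht x)
    refine (norm_add_le_of_le h1 h2).trans ?_
    have e : C * (2 * M) + 2 * M * η * (C / η) = 2 * M * C * (2 * η) / η := by
      field_simp
      ring
    rw [e]
    exact div_le_div_of_nonneg_right
      (mul_le_mul_of_nonneg_left (by linarith) (by positivity)) hη0.le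
  · rw [eP t ht]
    have h1 : ‖cut η (x - h t) • partialDeriv j (φ t) x‖ ≤ C * (2 * M) := by
      rw [norm_smul]
      exact mul_le_mul (k0.bound _) (hpb t ht j x) (norm_nonneg _) hC
    have h2 : ‖fderiv ℝ (cut η) (x - h t) (basisVec j) • φ t x‖ ≤ C / η * (2 * M) := by
      rw [norm_smul]
      exact mul_le_mul ((k0' j).bound _) (hb t ht x) (norm_nonneg _) (by positivity)
    have h3 := (k1' j).norm_smul_le_of_vanishing hM2 hη0 (hp t ht x)
    have h4 : ‖wedge (φ t x) (basisVec j) • cutCurl η (x - h t)‖ ≤ 2 * M * (C / η) := by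
      rw [norm_smul]
      exact mul_le_mul (hg t ht j x) (k1.bound _) (norm_nonneg _) hM2
    refine (norm_add_le_of_le (norm_add_le_of_le h1 h2) (norm_add_le_of_le h3 h4)).trans ?_
    have e : C * (2 * M) + C / η * (2 * M) + (2 * M * η * (C / η ^ 2) + 2 * M * (C / η)) =
        2 * M * C * (η + 3) / η := by
      field_simp
      ring
    rw [e]
    exact div_le_div_of_nonneg_right
      (mul_le_mul_of_nonneg_left (by linarith) (by positivity)) hη0.le

/-! ### Weak-* convergence -/

/-- In `hlim` the exceptional null set of times does not depend on `v`, so `v = ψ t` may be chosen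
time by time; `C * ‖ψ t‖` dominates. -/
theorem weakStarTendsto_of_pointwise {ι H : Type*} [NormedAddCommGroup H] [InnerProductSpace ℝ H]
    {l : Filter ι} [l.IsCountablyGenerated] {T C : ℝ} {f : ι → ℝ → H} {g : ℝ → H}
    (hf : ∀ᶠ i in l, MemLp (f i) ⊤ (volume.restrict (Ioo 0 T)))
    (hg : MemLp g ⊤ (volume.restrict (Ioo 0 T)))
    (hb : ∀ᶠ i in l, ∀ᵐ t ∂(volume.restrict (Ioo 0 T)), ‖f i t‖ ≤ C)
    (hlim : ∀ᵐ t ∂(volume.restrict (Ioo 0 T)), ∀ v,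
      Tendsto (fun i => inner ℝ (f i t) v) l (𝓝 (inner ℝ (g t) v))) :
    WeakStarTendsto T l f g where
  eventually_memLp := hf
  memLp_limit := hg
  tendsto ψ hψ := by
    refine tendsto_integral_filter_of_dominated_convergence (fun t => C * ‖ψ t‖) ?_ ?_
      (hψ.norm.const_mul C) ?_
    · filter_upwards [hf] with i hi using hi.1.inner hψ.1
    · filter_upwards [hb] with i hi
      filter_upwards [hi] with t ht
      exact (norm_inner_le_norm _ _).trans (mul_le_mul_of_nonneg_right ht (norm_nonneg _))
    · filter_upwards [hlim] with t ht using ht (ψ t)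

section Concentration

variable {Ω : Set Plane}

theorem norm_toH1_le_of_concentrated {f : Plane → Plane} {c : Plane} {C η : ℝ} (hη : 0 < η)
    (hf : SmoothCompact f) (hC : ∀ x, ‖f x‖ ≤ C / η) (hC' : ∀ j x, ‖partialDeriv j f x‖ ≤ C / η)
    (hs : ∀ x, η < ‖x - c‖ → f x = 0) (hs' : ∀ j x, η < ‖x - c‖ → partialDeriv j f x = 0) :
    ‖toH1 Ω f‖ ≤ 3 * (C * concNorm) :=
  norm_toH1_le hf (norm_toL2_le_of_concentrated hη hC hs)
    fun j => norm_toL2_le_of_concentrated hη (hC' j) (hs' j)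

theorem tendsto_inner_toH1_of_concentrated {f : ℝ → Plane → Plane} {c : Plane} {C : ℝ}
    (hf : ∀ᶠ η in 𝓝[>] (0 : ℝ), SmoothCompact (f η))
    (hC : ∀ᶠ η in 𝓝[>] (0 : ℝ), ∀ x, ‖f η x‖ ≤ C / η)
    (hC' : ∀ᶠ η in 𝓝[>] (0 : ℝ), ∀ j x, ‖partialDeriv j (f η) x‖ ≤ C / η)
    (hs : ∀ᶠ η in 𝓝[>] (0 : ℝ), ∀ x, η < ‖x - c‖ → f η x = 0)
    (hs' : ∀ᶠ η in 𝓝[>] (0 : ℝ), ∀ j x, η < ‖x - c‖ → partialDeriv j (f η) x = 0) (v : H1 Ω) :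
    Tendsto (fun η => inner ℝ (toH1 Ω (f η)) v) (𝓝[>] (0 : ℝ)) (𝓝 0) := by
  have h0 := tendsto_inner_toL2_of_concentrated (hf.mono fun η h => h.memLp Ω) hC hs (fieldOf v)
  have h1 := fun j => tendsto_inner_toL2_of_concentrated
    (hf.mono fun η h => (h.partialDeriv j).memLp Ω) (hC'.mono fun η h => h j)
    (hs'.mono fun η h => h j) (weakPartial v j)
  have h2 := h0.add (tendsto_finsetSum Finset.univ fun j _ => h1 j)
  simp only [Finset.sum_const_zero, add_zero] at h2
  refine h2.congr' ?_
  filter_upwards [hf] with η h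
  rw [inner_h1, fieldOf_toH1 h]
  simp only [weakPartial_toH1 h]

end Concentration

/-! ### Time derivatives of families of fields -/

namespace TimeField

variable {Ω : Set Plane} {T L : ℝ} {S : Set ℝ} {u : ℝ → Plane → Plane}

theorem norm_timeDeriv_le (hS : S ⊆ Ioo 0 T) (hu : TimeField T S L u) {C : ℝ} (hC : 0 ≤ C)
    (hlip : ∀ s ∈ Ico 0 T, ∀ t ∈ Ico 0 T, ∀ x, ‖u s x - u t x‖ ≤ C * |s - t|) {t : ℝ}
    (ht : t ∈ S) (x : Plane) : ‖timeDeriv u t x‖ ≤ C := by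
  refine (hu.diff t ht x).hasDerivAt.le_of_lip' hC ?_
  filter_upwards [Ico_mem_nhds (hS ht).1 (hS ht).2] with s hs
  exact hlip s hs t (Ioo_subset_Ico_self (hS ht)) x

theorem memLp_timeDeriv [IsFiniteMeasure (volume.restrict Ω)] (hS : S ⊆ Ioo 0 T)
    (hSae : ∀ᵐ t ∂(volume.restrict (Ioo 0 T)), t ∈ S) (hu : TimeField T S L u) :
    MemLp (fun t => toL2 Ω (timeDeriv u t)) ⊤ (volume.restrict (Ioo 0 T)) := by
  refine memLp_top_of_bound ?_ (supToL2 Ω * L) ?_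
  · refine (aestronglyMeasurable_deriv (fun s => toL2 Ω (u s)) _).congr ?_
    filter_upwards [hSae] with t ht
    exact (hu.hasDerivAt_toL2 hS ht).2.2.deriv
  · filter_upwards [hSae] with t ht
    exact norm_toL2_le (hu.hasDerivAt_toL2 (Ω := Ω) hS ht).2.1

theorem memLp_toH10 [IsFiniteMeasure (volume.restrict Ω)] (hu : TimeField T S L u)
    (htest : ∀ t ∈ Ico 0 T, IsTest Ω (u t)) :
    MemLp (fun t => (toH10 Ω (u t) : H1 Ω)) ⊤ (volume.restrict (Ioo 0 T)) :=
  memLp_top_of_norm_sub_le (C := 3 * (supToL2 Ω * L)) fun s hs t ht => by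
    rw [toH10_coe (htest s hs), toH10_coe (htest t ht)]
    exact hu.norm_toH1_sub_le hs ht

end TimeField

/-- The correction lives within distance `3/4 * η` of the moving point, so a point farther than `η`
at time `t` stays outside the support for nearby times. -/
theorem timeDeriv_movingCorrection_eq_zero {φ : ℝ → Plane → Plane} {h : ℝ → Plane} {η t : ℝ}
    (hη : 0 < η) (hc : ContinuousAt h t) {x : Plane} (hx : η < ‖x - h t‖) :
    timeDeriv (movingCorrection φ h η) t x = 0 := by
  have h0 : ContinuousAt (fun s => ‖x - h s‖) t := (continuousAt_const.sub hc).norm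
  have h1 : ∀ᶠ s in 𝓝 t, 3 / 4 * η < ‖x - h s‖ := h0.eventually_const_lt (by linarith)
  have h2 : (fun s => movingCorrection φ h η s x) =ᶠ[𝓝 t] fun _ => 0 :=
    h1.mono fun s hs => correction_eq_zero hη hs
  rw [timeDeriv, h2.deriv_eq, deriv_const]

/-! ### Supports of sums and of time slices of test fields -/

theorem IsTest.sub {Ω : Set Plane} {f g : Plane → Plane} (hf : IsTest Ω f) (hg : IsTest Ω g) :
    IsTest Ω fun x => f x - g x :=
  ⟨hf.1.sub hg.1, (tsupport_sub f g).trans (union_subset hf.2 hg.2)⟩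

theorem IsTest.sum {Ω : Set Plane} {ι : Type*} (s : Finset ι) {f : ι → Plane → Plane}
    (hf : ∀ i, IsTest Ω (f i)) : IsTest Ω fun x => ∑ i ∈ s, f i x := by
  classical
  refine ⟨SmoothCompact.sum s fun i => (hf i).1, ?_⟩
  induction s using Finset.induction_on with
  | empty => simp [tsupport]
  | insert i s hi ih =>
    simp only [Finset.sum_insert hi]
    exact (tsupport_add (f i) fun x => ∑ i ∈ s, f i x).trans (union_subset (hf i).2 ih)

theorem IsSpaceTimeTest.isTest {T : ℝ} {Ω : Set Plane} {φ : ℝ → Plane → Plane}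
    (hφ : IsSpaceTimeTest T Ω φ) {t : ℝ} (ht : t ∈ Ico 0 T) : IsTest Ω (φ t) := by
  obtain ⟨M, -, hM⟩ := hφ.exists_tameField
  obtain ⟨K, hK, hKs, hK0⟩ := hφ.compact_support
  refine ⟨hM.smooth t ht, (closure_minimal (t := (fun x => (t, x)) ⁻¹' K) (fun x hx => ?_)
    (hK.isClosed.preimage (by fun_prop))).trans fun x hx => (hKs hx).2⟩
  by_contra hxK
  exact hx (hK0 t ht x hxK)

theorem IsSpaceTimeTest.exists_vanishing {T : ℝ} {Ω : Set Plane} {φ : ℝ → Plane → Plane}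
    (hφ : IsSpaceTimeTest T Ω φ) (hT : 0 < T) :
    ∃ τ < T, ∀ t ∈ Ico 0 T, τ ≤ t → φ t = fun _ => 0 := by
  obtain ⟨K, hK, hKs, hK0⟩ := hφ.compact_support
  rcases K.eq_empty_or_nonempty with rfl | hne
  · exact ⟨0, hT, fun t ht _ => funext fun x => hK0 t ht x (notMem_empty _)⟩
  · obtain ⟨p, hp, hmax⟩ := hK.exists_isMaxOn hne continuous_fst.continuousOn
    have hpT : p.1 < T := (hKs hp).1.2
    -- The midpoint lies strictly between the last time `p.1` occurring in `K` and `T`.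
    refine ⟨(p.1 + T) / 2, by linarith, fun t ht hle => funext fun x => hK0 t ht x fun h => ?_⟩
    have : t ≤ p.1 := hmax h
    linarith

/-! ### The modified test fields -/

/-- The field obtained from `φ` by subtracting the corrections along the curves `h i`. -/
def modifiedField {N : ℕ} (φ : ℝ → Plane → Plane) (h : Fin N → ℝ → Plane) (η t : ℝ)
    (x : Plane) : Plane :=
  φ t x - ∑ i, movingCorrection φ (h i) η t x

theorem isTest_modifiedField {N : ℕ} {Ω : Set Plane} (hΩ : IsOpen Ω) {φ : ℝ → Plane → Plane}
    {h : Fin N → ℝ → Plane} {η t : ℝ} (hη : 0 < η) (hφ : IsTest Ω (φ t))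
    (hdiv : ∀ x, divergence (φ t) x = 0)
    (hdist : ∀ x ∈ tsupport (φ t), ∀ y ∈ frontier Ω, 2 * η ≤ dist x y) :
    IsTest Ω (modifiedField φ h η t) :=
  hφ.sub (IsTest.sum _ fun _ => isTest_correction hΩ hη hφ hdiv hdist)

theorem divergence_modifiedField {N : ℕ} {φ : ℝ → Plane → Plane} {h : Fin N → ℝ → Plane}
    {η t : ℝ} (hη : 0 < η) (hφ : SmoothCompact (φ t)) (hdiv : ∀ x, divergence (φ t) x = 0)
    (x : Plane) : divergence (modifiedField φ h η t) x = 0 := by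
  have hd : ∀ i, SmoothCompact (movingCorrection φ (h i) η t) := fun i =>
    smoothCompact_correction hη hφ.1 hdiv
  have h1 : ∀ j, partialDeriv j (modifiedField φ h η t) x =
      partialDeriv j (φ t) x - ∑ i, partialDeriv j (movingCorrection φ (h i) η t) x := fun j => by
    rw [← partialDeriv_sum _ fun i => (hd i).differentiable]
    exact partialDeriv_sub hφ.differentiable (SmoothCompact.sum _ hd).differentiable j x
  have h2 : divergence (modifiedField φ h η t) x =
      divergence (φ t) x - ∑ i, divergence (movingCorrection φ (h i) η t) x := by
    simp only [divergence, h1, PiLp.sub_apply, WithLp.ofLp_sum, Finset.sum_apply,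
      Finset.sum_sub_distrib]
    rw [Finset.sum_comm]
  rw [h2, hdiv, zero_sub, neg_eq_zero]
  exact Finset.sum_eq_zero fun i _ => divergence_correction hφ.1 hdiv x

/-- On the disc of radius `η/2` the `i`-th correction cancels `φ t`; every other centre is at
distance more than `2η - η/2`, beyond the reach `3/4 * η` of its correction. -/
theorem modifiedField_eq_zero {N : ℕ} {φ : ℝ → Plane → Plane} {h : Fin N → ℝ → Plane}
    {η t : ℝ} (hη : 0 < η) (hφ : SmoothCompact (φ t)) (hdiv : ∀ x, divergence (φ t) x = 0)
    (hsep : ∀ i j, i ≠ j → 2 * η ≤ dist (h i t) (h j t)) {i : Fin N} {x : Plane}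
    (hx : x ∈ Metric.ball (h i t) (η / 2)) : modifiedField φ h η t x = 0 := by
  rw [modifiedField, Finset.sum_eq_single i (fun j _ hj => ?_) (by simp)]
  · rw [movingCorrection, correction_eq_self hη hφ.1 hdiv hx, sub_self]
  · refine correction_eq_zero hη ?_
    have h1 := hsep i j hj.symm
    have h2 := dist_triangle_left (h i t) (h j t) x
    rw [Metric.mem_ball] at hx
    rw [← dist_eq_norm]
    linarith

theorem exists_norm_sub_le_of_lipschitzOnWith {T : ℝ} {h : ℝ → Plane}
    (hh : ∃ L : NNReal, LipschitzOnWith L h (Icc 0 T)) :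
    ∃ L : ℝ, 0 ≤ L ∧ ∀ s ∈ Ico 0 T, ∀ t ∈ Ico 0 T, ‖h s - h t‖ ≤ L * |s - t| := by
  obtain ⟨L, hL⟩ := hh
  refine ⟨L, L.2, fun s hs t ht => ?_⟩
  rw [← dist_eq_norm, ← Real.dist_eq]
  exact hL.dist_le_mul s (Ico_subset_Icc_self hs) t (Ico_subset_Icc_self ht)

theorem ae_differentiableAt_of_lipschitzOnWith {T : ℝ} {h : ℝ → Plane}
    (hh : ∃ L : NNReal, LipschitzOnWith L h (Icc 0 T)) :
    ∀ᵐ t ∂(volume.restrict (Ioo 0 T)), DifferentiableAt ℝ h t := by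
  obtain ⟨L, hL⟩ := hh
  filter_upwards [(hL.mono Ioo_subset_Icc_self).ae_differentiableWithinAt_real measurableSet_Ioo,
    ae_restrict_mem measurableSet_Ioo] with t ht hm
  exact ht.differentiableAt (isOpen_Ioo.mem_nhds hm)

end Fluid

end

/-! ### Modified test functions and their weak-* limits -/

open Fluid in
theorem mainTheorem7 (Ω : Set Fluid.Plane) (hΩ : IsOpen Ω) (hΩb : Bornology.IsBounded Ω)
    (T : ℝ) (hT : 0 < T)
    (N : ℕ) (h : Fin N → ℝ → Fluid.Plane)
    (hLip : ∀ i, ∃ L : NNReal, LipschitzOnWith L (h i) (Icc 0 T))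
    (φ : ℝ → Fluid.Plane → Fluid.Plane) (hφ : Fluid.IsSpaceTimeTest T Ω φ)
    (hdiv : ∀ t ∈ Ico 0 T, ∀ x, Fluid.divergence (φ t) x = 0)
    (η₁ : ℝ) (hη₁ : 0 < η₁)
    (hsep : ∀ t ∈ Icc 0 T, ∀ i j, i ≠ j → 2 * η₁ ≤ dist (h i t) (h j t))
    (hdist : ∀ t ∈ Ico 0 T, ∀ x ∈ tsupport (φ t), ∀ y ∈ frontier Ω, 2 * η₁ ≤ dist x y) :
    ∃ Φ dΦ : ℝ → ℝ → Fluid.H10 Ω,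
      (∀ η ∈ Ioc 0 η₁,
        Fluid.IsW1InftyC T (Φ η) (dΦ η) ∧
        (∀ t ∈ Ico 0 T, ∀ᵐ x ∂(volume.restrict Ω), Fluid.weakDiv (Φ η t : Fluid.H1 Ω) x = 0) ∧
        (∀ t ∈ Ico 0 T, ∀ i, ∀ᵐ x ∂(volume.restrict Ω),
          x ∈ Metric.ball (h i t) (η / 2) → Fluid.fieldOf (Φ η t : Fluid.H1 Ω) x = 0)) ∧
      Fluid.WeakStarTendsto T (𝓝[>] (0 : ℝ))
        (fun η t => (Φ η t : Fluid.H1 Ω)) (fun t => Fluid.toH1 Ω (φ t)) ∧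
      Fluid.WeakStarTendsto T (𝓝[>] (0 : ℝ))
        (fun η t => Fluid.fieldOf (dΦ η t : Fluid.H1 Ω))
        (fun t => Fluid.toL2 Ω (fun x => deriv (fun s => φ s x) t)) := by
  have : IsFiniteMeasure (volume.restrict Ω) := ⟨by simpa using hΩb.measure_lt_top⟩
  obtain ⟨M, hM, hMφ⟩ := hφ.exists_tameField
  choose L hL hhL using fun i => exists_norm_sub_le_of_lipschitzOnWith (hLip i)
  -- One set of good times for all curves and all `η`; the pointwise limits as `η → 0` are taken at
  -- a fixed time of `S`.
  set S : Set ℝ := {t | t ∈ Ioo 0 T ∧ ∀ i, DifferentiableAt ℝ (h i) t} with hSdef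
  have hS : S ⊆ Ioo 0 T := fun t ht => ht.1
  have hSae : ∀ᵐ t ∂(volume.restrict (Ioo 0 T)), t ∈ S := by
    filter_upwards [ae_restrict_mem measurableSet_Ioo,
      ae_all_iff.2 fun i => ae_differentiableAt_of_lipschitzOnWith (hLip i)] with t h1 h2
    exact ⟨h1, h2⟩
  choose C hC using fun i => exists_movingCorrection_bounds (η₁ := η₁) hMφ hM hdiv (hL i) (hhL i) hS
    fun t ht => ht.2 i
  have hTF : ∀ η ∈ Ioc 0 η₁, ∃ L', TimeField T S L' (modifiedField φ h η) := fun η hη => by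
    choose L' hL' using fun i => (hC i η hη).1
    exact ⟨_, (hMφ.timeField.mono hS).sub hS (TimeField.sum hS hL')⟩
  have hsm : ∀ t ∈ Ico 0 T, SmoothCompact (φ t) := hMφ.smooth
  have htest : ∀ η ∈ Ioc 0 η₁, ∀ t ∈ Ico 0 T, IsTest Ω (modifiedField φ h η t) :=
    fun η hη t ht => isTest_modifiedField hΩ hη.1 (hφ.isTest ht) (hdiv t ht) fun x hx y hy =>
      le_trans (by linarith [hη.2]) (hdist t ht x hx y hy)
  have hvan : ∀ η ∈ Ioc 0 η₁, ∃ τ < T, ∀ t ∈ Ico 0 T, τ ≤ t →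
      modifiedField φ h η t = fun _ => 0 := fun η hη => by
    obtain ⟨τ, hτ, h0⟩ := hφ.exists_vanishing hT
    refine ⟨τ, hτ, fun t ht hle => funext fun x => ?_⟩
    have h1 : ∀ i, movingCorrection φ (h i) η t x = 0 := fun i => congrFun
      (correction_eq_zero_of_vanishing hη.1 fun y _ => congrFun (h0 t ht hle) y) x
    simp [modifiedField, h0 t ht hle, h1]
  -- Stated for every real `η`, with the value `0` outside `(0, η₁]`, so that the choice yields a
  -- total function.
  have hex : ∀ η, ∃ dU : ℝ → H10 Ω, η ∈ Ioc 0 η₁ →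
      IsW1InftyC T (fun t => toH10 Ω (modifiedField φ h η t)) dU ∧
      ∀ t ∈ S, fieldOf (dU t : H1 Ω) = toL2 Ω (timeDeriv (modifiedField φ h η) t) := fun η => by
    by_cases hη : η ∈ Ioc 0 η₁
    · obtain ⟨L', hL'⟩ := hTF η hη
      obtain ⟨dU, hdU⟩ := hL'.exists_isW1InftyC hS hSae (htest η hη) (hvan η hη)
      exact ⟨dU, fun _ => hdU⟩
    · exact ⟨0, fun hη' => absurd hη' hη⟩
  choose dΦ hdΦ using hex
  have hev : ∀ᶠ η in 𝓝[>] (0 : ℝ), η ∈ Ioc 0 η₁ := Ioc_mem_nhdsGT hη₁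
  have hmc : ∀ i, ∀ η ∈ Ioc 0 η₁, ∀ t ∈ Ico 0 T, SmoothCompact (movingCorrection φ (h i) η t) :=
    fun i η hη t ht => smoothCompact_correction hη.1 (hsm t ht).1 (hdiv t ht)
  have hC0 : ∀ i, ∀ η ∈ Ioc 0 η₁, 0 ≤ C i / η := fun i η hη =>
    (norm_nonneg _).trans ((hC i η hη).2.1 0 ⟨le_rfl, hT⟩ 0)
  have hz : ∀ i (η : ℝ), η ∈ Ioc 0 η₁ → ∀ t x, η < ‖x - h i t‖ →
      movingCorrection φ (h i) η t x = 0 := fun i η hη t x hx =>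
    correction_eq_zero hη.1 (by linarith [hη.1])
  have hz' : ∀ i (η : ℝ), η ∈ Ioc 0 η₁ → ∀ t j x, η < ‖x - h i t‖ →
      partialDeriv j (movingCorrection φ (h i) η t) x = 0 := fun i η hη t j x hx =>
    partialDeriv_correction_eq_zero hη.1 j (by linarith [hη.1])
  refine ⟨fun η t => toH10 Ω (modifiedField φ h η t), dΦ, fun η hη => ⟨(hdΦ η hη).1,
    fun t ht => ?_, fun t ht i => ?_⟩, ?_, ?_⟩
  · rw [toH10_coe (htest η hη t ht)]
    filter_upwards [weakDiv_toH1 (htest η hη t ht).1] with x hx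
    rw [hx, divergence_modifiedField hη.1 (hsm t ht) (hdiv t ht)]
  · rw [toH10_coe (htest η hη t ht), fieldOf_toH1 (htest η hη t ht).1]
    filter_upwards [toL2_coe ((htest η hη t ht).1.memLp Ω)] with x hx hxb
    rw [hx]
    exact modifiedField_eq_zero hη.1 (hsm t ht) (hdiv t ht) (fun i j hij =>
      le_trans (by linarith [hη.2]) (hsep t (Ico_subset_Icc_self ht) i j hij)) hxb
  -- Convergence in `H¹`: each correction is bounded uniformly in `η` and tends weakly to zero at
  -- every time.
  · have heq : ∀ η ∈ Ioc 0 η₁, ∀ t ∈ Ico 0 T, (toH10 Ω (modifiedField φ h η t) : H1 Ω) =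
        toH1 Ω (φ t) - ∑ i, toH1 Ω (movingCorrection φ (h i) η t) := fun η hη t ht => by
      rw [toH10_coe (htest η hη t ht), ← toH1_sum _ fun i => hmc i η hη t ht]
      exact toH1_sub (hsm t ht) (SmoothCompact.sum _ fun i => hmc i η hη t ht)
    refine weakStarTendsto_of_pointwise
      (C := 3 * (supToL2 Ω * M) + ∑ i, 3 * (C i * concNorm)) ?_ ?_ ?_ ?_
    · filter_upwards [hev] with η hη
      obtain ⟨L', hL'⟩ := hTF η hη
      exact hL'.memLp_toH10 (htest η hη)
    · exact memLp_top_of_norm_sub_le fun s hs t ht => hMφ.timeField.norm_toH1_sub_le hs ht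
    · filter_upwards [hev] with η hη
      filter_upwards [ae_restrict_mem measurableSet_Ioo] with t ht'
      have ht := Ioo_subset_Ico_self ht'
      rw [heq η hη t ht]
      refine (norm_sub_le _ _).trans (add_le_add ?_ (norm_sum_le_of_le _ fun i _ => ?_))
      · exact norm_toH1_le (hsm t ht) (norm_toL2_le (hMφ.bound t ht))
          fun j => norm_toL2_le (hMφ.bound_partial t ht j)
      · exact norm_toH1_le_of_concentrated hη.1 (hmc i η hη t ht) ((hC i η hη).2.1 t ht)
          ((hC i η hη).2.2.1 t ht) (hz i η hη t) (hz' i η hη t)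
    · filter_upwards [ae_restrict_mem measurableSet_Ioo] with t ht' v
      have ht := Ioo_subset_Ico_self ht'
      have h1 := tendsto_finsetSum Finset.univ fun i _ =>
        tendsto_inner_toH1_of_concentrated (f := fun η => movingCorrection φ (h i) η t)
          (c := h i t) (C := C i) (hev.mono fun η hη => hmc i η hη t ht)
          (hev.mono fun η hη => (hC i η hη).2.1 t ht)
          (hev.mono fun η hη => (hC i η hη).2.2.1 t ht)
          (hev.mono fun η hη => hz i η hη t) (hev.mono fun η hη => hz' i η hη t) v
      have h2 := h1.const_sub (inner ℝ (toH1 Ω (φ t)) v)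
      rw [Finset.sum_const_zero, sub_zero] at h2
      refine h2.congr' ?_
      filter_upwards [hev] with η hη
      rw [heq η hη t ht, inner_sub_left, sum_inner]
  -- Time derivatives converge only in `L²`: the `C / η` bound is available for the derivative
  -- itself, not for its gradient.
  · have hd : ∀ i, ∀ η ∈ Ioc 0 η₁, ∀ t ∈ S,
        MemLp (timeDeriv (movingCorrection φ (h i) η) t) 2 (volume.restrict Ω) ∧
        (∀ x, ‖timeDeriv (movingCorrection φ (h i) η) t x‖ ≤ C i / η) ∧
        ∀ x, DifferentiableAt ℝ (fun s => movingCorrection φ (h i) η s x) t :=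
      fun i η hη t ht => by
        obtain ⟨L', hL'⟩ := (hC i η hη).1
        exact ⟨(hL'.hasDerivAt_toL2 hS ht).1,
          hL'.norm_timeDeriv_le hS (hC0 i η hη) (hC i η hη).2.2.2 ht, hL'.diff t ht⟩
    have hzd : ∀ i, ∀ η ∈ Ioc 0 η₁, ∀ t ∈ S, ∀ x, η < ‖x - h i t‖ →
        timeDeriv (movingCorrection φ (h i) η) t x = 0 := fun i η hη t ht x hx =>
      timeDeriv_movingCorrection_eq_zero hη.1 (ht.2 i).continuousAt hx
    have hφd : ∀ t ∈ S, MemLp (timeDeriv φ t) 2 (volume.restrict Ω) ∧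
        ∀ x, ‖timeDeriv φ t x‖ ≤ M := fun t ht => by
      have := hMφ.timeField.hasDerivAt_toL2 (Ω := Ω) Subset.rfl (hS ht)
      exact ⟨this.1, this.2.1⟩
    have heq : ∀ η ∈ Ioc 0 η₁, ∀ t ∈ S, fieldOf (dΦ η t : H1 Ω) =
        toL2 Ω (timeDeriv φ t) - ∑ i, toL2 Ω (timeDeriv (movingCorrection φ (h i) η) t) :=
      fun η hη t ht => by
        rw [(hdΦ η hη).2 t ht, ← toL2_sum _ fun i => (hd i η hη t ht).1,
          ← toL2_sub (hφd t ht).1 (memLp_finsetSum _ fun i _ => (hd i η hη t ht).1)]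
        congr 1
        funext x
        exact ((hMφ.diff_time (hS ht) x).hasDerivAt.sub
          (HasDerivAt.fun_sum fun i _ => ((hd i η hη t ht).2.2 x).hasDerivAt)).deriv
    refine weakStarTendsto_of_pointwise
      (C := supToL2 Ω * M + ∑ i, C i * concNorm) ?_ ?_ ?_ ?_
    · filter_upwards [hev] with η hη
      obtain ⟨L', hL'⟩ := hTF η hη
      refine (memLp_congr_ae ?_).2 (hL'.memLp_timeDeriv (Ω := Ω) hS hSae)
      filter_upwards [hSae] with t ht using (hdΦ η hη).2 t ht
    · exact (hMφ.timeField.mono hS).memLp_timeDeriv hS hSae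
    · filter_upwards [hev] with η hη
      filter_upwards [hSae] with t ht
      rw [heq η hη t ht]
      refine (norm_sub_le _ _).trans (add_le_add ?_ (norm_sum_le_of_le _ fun i _ => ?_))
      · exact norm_toL2_le (hφd t ht).2
      · exact norm_toL2_le_of_concentrated hη.1 (hd i η hη t ht).2.1 (hzd i η hη t ht)
    · filter_upwards [hSae] with t ht v
      have h1 := tendsto_finsetSum Finset.univ fun i _ =>
        tendsto_inner_toL2_of_concentrated (f := fun η => timeDeriv (movingCorrection φ (h i) η) t)
          (c := h i t) (C := C i) (hev.mono fun η hη => (hd i η hη t ht).1)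
          (hev.mono fun η hη => (hd i η hη t ht).2.1) (hev.mono fun η hη => hzd i η hη t ht) v
      have h2 := h1.const_sub (inner ℝ (toL2 Ω (timeDeriv φ t)) v)
      rw [Finset.sum_const_zero, sub_zero] at h2
      refine h2.congr' ?_
      filter_upwards [hev] with η hη
      rw [heq η hη t ht, inner_sub_left, sum_inner]
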